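/- Let $r\ge 2$. An $r$-graph is an $r$-uniform hypergraph. For an $r$-graph $H$, the minimum codegree $\delta_{r-1}(H)$ is the minimum, over all $(r-1)$-element sets $S$ of vertices of $H$, of the number of edges of $H$ containing $S$. For an $r$-graph $F$, let $\mathrm{ex}_{r-1}(n,F)$ be the maximum of $\delta_{r-1}(H)$ over all $n$-vertex $r$-graphs $H$ that contain no copy of $F$ as a (not necessarily induced) subhypergraph, and let $\gamma(F)=\lim_{n\to\infty}\mathrm{ex}_{r-1}(n,F)/n$ be the codegree Turán density of $F$. For $\ell>r$, the tight cycle $\mathcal{C}_\ell^r$ is the $r$-graph with vertex set $\{0,1,\dots,\ell-1\}$ and edges $\{i,i+1,\dots,i+r-1\}$ for $0\le i<\ell$, where addition is modulo $\ell$. **Theorem 1.1.** (a) For every $r\ge 2$ and every $k\not\equiv 0\pmod r$ such that $r/\gcd(r,k)$ is odd, there is an integer $L$ such that for every $\ell>L$ with $\ell>r$ and $\ell\equiv k\pmod r$, the limit defining $\gamma(\mathcal{C}_\ell^r)$ exists and $$\gamma(\mathcal{C}_\ell^r)\le \tfrac13 .$$ (b) For every $r\ge 2$ there is an integer $L$ such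 that for every $\ell>L$ with $\ell>r$ for which the smallest prime divisor of $r/\gcd(r,\ell)$ is $3$, the limit defining $\gamma(\mathcal{C}_\ell^r)$ exists and $$\gamma(\mathcal{C}_\ell^r)=\tfrac13 .$$ -/

import Mathlib

open Filter Topology

/-- An `r`-uniform hypergraph (an `r`-graph) with vertex set `V`: a set of `r`-element subsets
of `V`. -/
@[ext]
structure RGraph (V : Type*) (r : ℕ) where
  edges : Set (Finset V)
  card_eq : ∀ e ∈ edges, e.card = r

namespace RGraph

/-- `F` is (isomorphic to) a subhypergraph of `H`: some injection of the vertices of `F` into the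
vertices of `H` maps every edge of `F` to an edge of `H`. -/
def IsContained {W V : Type*} {r : ℕ} (F : RGraph W r) (H : RGraph V r) : Prop :=
  ∃ f : W ↪ V, ∀ e ∈ F.edges, e.map f ∈ H.edges

/-- `H` is `F`-free. -/
def Free {W V : Type*} {r : ℕ} (F : RGraph W r) (H : RGraph V r) : Prop :=
  ¬ F.IsContained H

/-- The degree `d(S)`: the number of edges of `H` that contain `S`. -/
noncomputable def degree {V : Type*} {r : ℕ} (H : RGraph V r) (S : Finset V) : ℕ :=
  {e ∈ H.edges | S ⊆ e}.ncard

/-- The minimum `i`-degree `δ_i(H)`: the minimum of `d(S)` over all `i`-element sets `S` of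
vertices (and `0` if there is no such set). -/
noncomputable def minDegree {V : Type*} {r : ℕ} (i : ℕ) (H : RGraph V r) : ℕ :=
  sInf {d | ∃ S : Finset V, S.card = i ∧ H.degree S = d}

/-- The codegree Turán number `ex_{r-1}(n, F)`: the maximum of `δ_{r-1}(H)` over all `F`-free
`r`-graphs `H` on `n` vertices. -/
noncomputable def codegreeTuranNumber {W : Type*} {r : ℕ} (F : RGraph W r) (n : ℕ) : ℕ :=
  sSup {d | ∃ H : RGraph (Fin n) r, F.Free H ∧ H.minDegree (r - 1) = d}

/-- The codegree Turán density `γ(F) = lim_{n → ∞} ex_{r-1}(n, F) / n`. -/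
noncomputable def codegreeTuranDensity {W : Type*} {r : ℕ} (F : RGraph W r) : ℝ :=
  limUnder atTop (fun n : ℕ => (F.codegreeTuranNumber n : ℝ) / n)

/-- The defining limit of the codegree Turán density of `F` exists. -/
def HasCodegreeTuranDensity {W : Type*} {r : ℕ} (F : RGraph W r) : Prop :=
  Tendsto (fun n : ℕ => (F.codegreeTuranNumber n : ℝ) / n) atTop (𝓝 F.codegreeTuranDensity)

end RGraph

/-- The `r`-uniform tight cycle `C_ℓ^r` of length `ℓ > r`: its vertices are the residues modulo
`ℓ`, and its edges are the sets `{i, i + 1, …, i + r - 1}`. -/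
def tightCycle (r ℓ : ℕ) (hℓ : r < ℓ) : RGraph (ZMod ℓ) r where
  edges := {e | ∃ i : ZMod ℓ, e = (Finset.range r).image (fun j : ℕ => i + (j : ZMod ℓ))}
  card_eq := by
    rintro e ⟨i, rfl⟩
    rw [Finset.card_image_of_injOn, Finset.card_range]
    intro a ha b hb hab
    have ha' : a < ℓ := (Finset.mem_range.mp ha).trans hℓ
    have hb' : b < ℓ := (Finset.mem_range.mp hb).trans hℓ
    have h : (a : ZMod ℓ) = (b : ZMod ℓ) := add_left_cancel hab
    rw [ZMod.natCast_eq_natCast_iff'] at h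
    rwa [Nat.mod_eq_of_lt ha', Nat.mod_eq_of_lt hb'] at h

/-! Upper bound. Call a replacement of one entry of an ordered edge by which it stays an edge a
step. If some ordered edge `x`, indexed by `ZMod r`, reaches its shift `x ∘ c`, with `c` the
translation by `-ℓ`, in few steps, then the tight cycle maps homomorphically into `H`: writing the
successive ordered edges one after another gives a word that closes up at length `ℓ` and whose
windows of length `r` are edges. Call two vertices of an edge exchangeable if five steps swap them.
Codegree above `n / 3` forces, among any three vertices of an edge, an exchangeable pair. If no
shift were reachable within `35 * r` steps, exchangeability would be an equivalence relation with
exactly two classes on every edge, preserved by steps (`Avoids.isClassSystem`).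

Such a system is rigid. If the link of an `(r - 2)`-set `T` has an edge joining different classes,
the link is bipartite and one 2-colouring of all vertices induces the classes on every edge
containing `T` (`exists_isProper_true`). The same colouring works for all `(r - 2)`-sets with
equally many vertices of colour `true` (`isProper_of_colorCount`), and this number can be lowered by
two until it is `0` (`isPerfect_sub_two`), so it is even. By symmetry in the colours, every odd `d ≤
r` is the size of a class of some edge (`exists_edge_colorCount_eq`). When `r / gcd(r, ℓ)` is odd,
the residues divisible by the gcd form a `c`-invariant set of odd size. Placing a class of that size
on these positions gives an ordering on which `c` moves entries only within classes, so `x ∘ c` is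
reachable by exchanges after all.

Passing to copies. Most random samples inherit the codegree density. This makes the limit exist, and
it makes one fixed homomorphism appear in a positive proportion of the samples; a large box of such
samples is a blow-up in which the homomorphism becomes injective.

Lower bound. Take the `r`-sets of sum `1` modulo `p`. Along a tight cycle the residues would have
period `gcd(r, ℓ)`, so an edge sum would be a multiple of `r / gcd(r, ℓ)`, which vanishes modulo
`p`. -/

set_option linter.unusedSectionVars false

namespace RGraph

/-! ### Neighbourhoods of `(r - 1)`-sets and the pigeonhole principle. -/

section Neighbors

variable {V : Type*} [Fintype V] [DecidableEq V] {r : ℕ}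

open Classical in
/-- The vertices that complete `S` to an edge of `H`. -/
noncomputable def neighbors (H : RGraph V r) (S : Finset V) : Finset V :=
  Finset.univ.filter fun v => v ∉ S ∧ insert v S ∈ H.edges

theorem mem_neighbors {H : RGraph V r} {S : Finset V} {v : V} :
    v ∈ H.neighbors S ↔ v ∉ S ∧ insert v S ∈ H.edges := by
  simp [neighbors]

theorem degree_eq_card_neighbors (H : RGraph V r) {S : Finset V} (hS : S.card + 1 = r) :
    H.degree S = (H.neighbors S).card := by
  have h : {e ∈ H.edges | S ⊆ e} = (fun v => insert v S) '' (H.neighbors S : Set V) := by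
    ext e
    simp only [Set.mem_ofPred_eq, Set.mem_image, Finset.mem_coe, mem_neighbors]
    constructor
    · rintro ⟨he, hSe⟩
      have hc := H.card_eq e he
      obtain ⟨v, hv⟩ : ∃ v, e \ S = {v} := by
        rw [← Finset.card_eq_one, Finset.card_sdiff_of_subset hSe]; omega
      have hve : v ∈ e \ S := by simp [hv]
      rw [Finset.mem_sdiff] at hve
      have : insert v S = e := by
        apply Finset.eq_of_subset_of_card_le
        · exact Finset.insert_subset hve.1 hSe
        · rw [Finset.card_insert_of_notMem hve.2]; omega
      exact ⟨v, ⟨hve.2, this ▸ he⟩, this⟩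
    · rintro ⟨v, ⟨-, hv⟩, rfl⟩
      exact ⟨hv, Finset.subset_insert _ _⟩
  rw [degree, h, Set.InjOn.ncard_image, Set.ncard_coe_finset]
  intro u hu v hv huv
  have hu' := (mem_neighbors.1 hu).1
  have : u ∈ insert v S := by
    rw [← show insert u S = insert v S from huv]; exact Finset.mem_insert_self _ _
  simpa [hu'] using this

end Neighbors

/-- This pigeonhole is where the constant `1 / 3` comes from: three sets of density above `1 / 3`
cannot be pairwise disjoint. -/
theorem exists_mem_two_of_card {V : Type*} [Fintype V] [DecidableEq V] {A B C : Finset V}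
    (h : Fintype.card V < A.card + B.card + C.card) :
    (∃ z, z ∈ A ∧ z ∈ B) ∨ (∃ z, z ∈ A ∧ z ∈ C) ∨ ∃ z, z ∈ B ∧ z ∈ C := by
  by_contra! hc
  obtain ⟨h1, h2, h3⟩ := hc
  have hAB : Disjoint A B := Finset.disjoint_left.2 h1
  have hABC : Disjoint (A ∪ B) C := by
    rw [Finset.disjoint_union_left]
    exact ⟨Finset.disjoint_left.2 h2, Finset.disjoint_left.2 h3⟩
  have := Finset.card_le_univ ((A ∪ B) ∪ C)
  rw [Finset.card_union_of_disjoint hABC, Finset.card_union_of_disjoint hAB] at this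
  omega

end RGraph

/-! ### Class systems and link graphs. -/

namespace RGraph

variable {V : Type*} [Fintype V] [DecidableEq V] {r : ℕ}

/-- A family of equivalence relations on the edges of `H`, each with exactly two classes, that is
invariant under exchanging one vertex of an edge, and that identifies the ends of an edge of the
link graph of an `(r - 2)`-set joined by a walk of length four in that link graph. -/
structure IsClassSystem (H : RGraph V r) (E : Finset V → V → V → Prop) : Prop where
  refl : ∀ e ∈ H.edges, ∀ u ∈ e, E e u u
  symm : ∀ e ∈ H.edges, ∀ u ∈ e, ∀ v ∈ e, E e u v → E e v u
  trans : ∀ e ∈ H.edges, ∀ u ∈ e, ∀ v ∈ e, ∀ w ∈ e, E e u v → E e v w → E e u w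
  three : ∀ e ∈ H.edges, ∀ u ∈ e, ∀ v ∈ e, ∀ w ∈ e, E e u v ∨ E e u w ∨ E e v w
  nontrivial : ∀ e ∈ H.edges, ∃ u ∈ e, ∃ v ∈ e, ¬ E e u v
  replace_of_mem : ∀ S x y, x ∉ S → y ∉ S → insert x S ∈ H.edges → insert y S ∈ H.edges →
    ∀ u ∈ S, ∀ v ∈ S, E (insert x S) u v → E (insert y S) u v
  replace_new : ∀ S x y, x ∉ S → y ∉ S → insert x S ∈ H.edges → insert y S ∈ H.edges →
    ∀ u ∈ S, E (insert x S) u x → E (insert y S) u y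
  odd_walk : ∀ T : Finset V, T.card + 2 = r → ∀ u s w t v, insert u (insert v T) ∈ H.edges →
    insert u (insert s T) ∈ H.edges → insert s (insert w T) ∈ H.edges →
    insert w (insert t T) ∈ H.edges → insert t (insert v T) ∈ H.edges →
    E (insert u (insert v T)) u v

/-- Adjacency in the link graph of `T`. -/
def Link (H : RGraph V r) (T : Finset V) (u v : V) : Prop :=
  insert u (insert v T) ∈ H.edges

/-- Every `(r - 1)`-set has more than `|V| / 3 + r` neighbours. -/
def LargeCodegree (H : RGraph V r) : Prop :=
  ∀ S : Finset V, S.card + 1 = r → Fintype.card V + 3 * r < 3 * (H.neighbors S).card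

theorem Link.symm {H : RGraph V r} {T : Finset V} {u v : V} (h : H.Link T u v) :
    H.Link T v u := by
  unfold Link at *
  rwa [Finset.insert_comm]

theorem Link.distinct {H : RGraph V r} {T : Finset V} {u v : V} (hT : T.card + 2 = r)
    (h : H.Link T u v) : u ≠ v ∧ u ∉ T ∧ v ∉ T := by
  have hc := H.card_eq _ h
  refine ⟨?_, ?_, ?_⟩
  · rintro rfl
    rw [Finset.insert_idem] at hc
    have := Finset.card_insert_le u T
    omega
  · intro hu
    rw [Finset.insert_eq_of_mem (Finset.mem_insert_of_mem hu)] at hc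
    have := Finset.card_insert_le v T
    omega
  · intro hv
    rw [Finset.insert_eq_of_mem hv] at hc
    have := Finset.card_insert_le u T
    omega

theorem mem_neighbors_insert {H : RGraph V r} {T : Finset V} {u z : V} (hT : T.card + 2 = r) :
    z ∈ H.neighbors (insert u T) ↔ H.Link T u z := by
  rw [mem_neighbors]
  constructor
  · rintro ⟨-, h⟩
    exact Link.symm h
  · intro h
    have hd := h.distinct hT
    refine ⟨?_, h.symm⟩
    rw [Finset.mem_insert]
    rintro (rfl | hz)
    · exact hd.1 rfl
    · exact hd.2.2 hz

theorem LargeCodegree.card_lt {H : RGraph V r} (hH : H.LargeCodegree) {T : Finset V} {u : V}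
    (hT : T.card + 2 = r) (hu : u ∉ T) :
    Fintype.card V + 3 * r < 3 * (H.neighbors (insert u T)).card :=
  hH _ (by rw [Finset.card_insert_of_notMem hu]; omega)

theorem LargeCodegree.exists_link {H : RGraph V r} (hH : H.LargeCodegree) {T : Finset V} {u : V}
    (hT : T.card + 2 = r) (hu : u ∉ T) : ∃ v, H.Link T u v := by
  have := hH.card_lt hT hu
  obtain ⟨v, hv⟩ := Finset.card_pos.1 (show 0 < (H.neighbors (insert u T)).card by omega)
  exact ⟨v, (mem_neighbors_insert hT).1 hv⟩

theorem LargeCodegree.exists_common_link {H : RGraph V r} (hH : H.LargeCodegree) {T : Finset V}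
    {u v w : V} (hT : T.card + 2 = r) (hu : u ∉ T) (hv : v ∉ T) (hw : w ∉ T) :
    (∃ z, H.Link T u z ∧ H.Link T v z) ∨ (∃ z, H.Link T u z ∧ H.Link T w z) ∨
      ∃ z, H.Link T v z ∧ H.Link T w z := by
  have h1 := hH.card_lt hT hu
  have h2 := hH.card_lt hT hv
  have h3 := hH.card_lt hT hw
  simpa only [mem_neighbors_insert hT] using exists_mem_two_of_card
    (show Fintype.card V < (H.neighbors (insert u T)).card + (H.neighbors (insert v T)).card +
      (H.neighbors (insert w T)).card by omega)

theorem exists_eq_insert_insert {H : RGraph V r} {T e : Finset V} (hT : T.card + 2 = r)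
    (he : e ∈ H.edges) (hTe : T ⊆ e) : ∃ u v, e = insert u (insert v T) ∧ H.Link T u v := by
  have hc : (e \ T).card = 2 := by
    rw [Finset.card_sdiff_of_subset hTe, H.card_eq e he]; omega
  obtain ⟨u, v, -, huv⟩ := Finset.card_eq_two.1 hc
  have : e = insert u (insert v T) := by
    rw [← Finset.sdiff_union_of_subset hTe, huv]
    ext; simp
  exact ⟨u, v, this, by rwa [Link, ← this]⟩

theorem link_erase_erase {H : RGraph V r} {e : Finset V} {u v : V} (he : e ∈ H.edges)
    (hu : u ∈ e) (hv : v ∈ e) (huv : u ≠ v) :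
    ((e.erase u).erase v).card + 2 = r ∧ insert u (insert v ((e.erase u).erase v)) = e ∧
      H.Link ((e.erase u).erase v) u v := by
  have hv' : v ∈ e.erase u := Finset.mem_erase.2 ⟨huv.symm, hv⟩
  have heq : insert u (insert v ((e.erase u).erase v)) = e := by
    rw [Finset.insert_erase hv', Finset.insert_erase hu]
  refine ⟨?_, heq, ?_⟩
  · have h1 := Finset.card_erase_add_one hu
    have h2 := Finset.card_erase_add_one hv'
    have := H.card_eq e he
    omega
  · rw [Link, heq]; exact he

namespace IsClassSystem

variable {H : RGraph V r} {E : Finset V → V → V → Prop} {T : Finset V} {u v w z : V}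

theorem merged_symm (hE : H.IsClassSystem E) (h : H.Link T u v)
    (hm : E (insert u (insert v T)) u v) : E (insert v (insert u T)) v u := by
  rw [Finset.insert_comm]
  exact hE.symm _ h _ (by simp) _ (by simp) hm

/-- Call a link edge merged if its ends are equivalent in the edge that it spans with `T`. Replacing
one end preserves this, so mergedness spreads along the link graph. -/
theorem merged_link (hE : H.IsClassSystem E) (hT : T.card + 2 = r) (h : H.Link T u v)
    (h' : H.Link T u w) (hm : E (insert u (insert v T)) u v) : E (insert u (insert w T)) u w := by
  have hd := h.distinct hT
  have hd' := h'.distinct hT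
  rw [Finset.insert_comm] at hm ⊢
  refine hE.replace_new (insert u T) v w ?_ ?_ h.symm h'.symm u (by simp) hm
  · simp [hd.1.symm, hd.2.2]
  · simp [hd'.1.symm, hd'.2.2]

/-- A triangle `u`, `z`, `v` contains the degenerate walk `u z u z v` of length four, which would
merge `u` and `v`. -/
theorem not_common_link (hE : H.IsClassSystem E) (hT : T.card + 2 = r) (h : H.Link T u v)
    (hm : ¬ E (insert u (insert v T)) u v) (hz : H.Link T u z) : ¬ H.Link T v z := fun hz' =>
  hm (hE.odd_walk T hT u z u z v h hz hz.symm hz hz'.symm)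

/-- An unmerged link edge makes the link graph connected: every vertex outside `T` is within
distance two of one of its ends. -/
theorem exists_link_left_or_right (hE : H.IsClassSystem E) (hH : H.LargeCodegree)
    (hT : T.card + 2 = r) (h : H.Link T u v) (hm : ¬ E (insert u (insert v T)) u v) (hw : w ∉ T) :
    (∃ z, H.Link T u z ∧ H.Link T w z) ∨ ∃ z, H.Link T v z ∧ H.Link T w z := by
  have hd := h.distinct hT
  rcases hH.exists_common_link hT hd.2.1 hd.2.2 hw with ⟨z, hz, hz'⟩ | h' | h'
  · exact absurd hz' (hE.not_common_link hT h hm hz)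
  · exact Or.inl h'
  · exact Or.inr h'

/-- Mergedness of `w z` would travel through a common neighbour of `w` and `u`, or of `w` and `v`,
to the edge `u v`. Hence the link edges of `T` are all merged or all unmerged. -/
theorem not_merged (hE : H.IsClassSystem E) (hH : H.LargeCodegree) (hT : T.card + 2 = r)
    (h : H.Link T u v) (hm : ¬ E (insert u (insert v T)) u v) (h' : H.Link T w z) :
    ¬ E (insert w (insert z T)) w z := by
  intro hm'
  rcases hE.exists_link_left_or_right hH hT h hm (h'.distinct hT).2.1 with ⟨y, hy, hy'⟩ | ⟨y, hy, hy'⟩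
  · have h1 := hE.merged_link hT h' hy' hm'
    have h2 := hE.merged_link hT hy'.symm hy.symm (hE.merged_symm hy' h1)
    exact hm (hE.merged_link hT hy h (hE.merged_symm hy.symm h2))
  · have h1 := hE.merged_link hT h' hy' hm'
    have h2 := hE.merged_link hT hy'.symm hy.symm (hE.merged_symm hy' h1)
    exact hm (hE.merged_symm h.symm (hE.merged_link hT hy h.symm (hE.merged_symm hy.symm h2)))

end IsClassSystem

/-- The colouring `χ` induces the classes on all edges that contain `T`, and the link graph of `T`
is bipartite with respect to `χ`. -/
structure IsProper (H : RGraph V r) (E : Finset V → V → V → Prop) (χ : V → Bool) (T : Finset V) :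
    Prop where
  classes : ∀ e ∈ H.edges, T ⊆ e → ∀ a ∈ e, ∀ b ∈ e, (E e a b ↔ χ a = χ b)
  ne_of_link : ∀ u v, H.Link T u v → χ u ≠ χ v

theorem IsProper.not {H : RGraph V r} {E : Finset V → V → V → Prop} {χ : V → Bool} {T : Finset V}
    (h : H.IsProper E χ T) : H.IsProper E (fun v => !χ v) T :=
  ⟨fun e he hTe a ha b hb => by rw [h.classes e he hTe a ha b hb]; simp,
    fun u v huv => by simpa using h.ne_of_link u v huv⟩

/-! ### The colouring attached to an `(r - 2)`-set. -/

namespace IsClassSystem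

variable {H : RGraph V r} {E : Finset V → V → V → Prop} {T : Finset V} {u v w z : V}

theorem exists_isProper_true (hE : H.IsClassSystem E) (hH : H.LargeCodegree)
    (hT : T.card + 2 = r) (h : H.Link T u v) (hm : ¬ E (insert u (insert v T)) u v) :
    ∃ χ : V → Bool, H.IsProper E χ T ∧ χ u = true := by
  classical
  -- Outside `T`, the side of `u` consists of the vertices sharing a link neighbour with `u`; inside
  -- `T`, it is read off from the classes of the single edge spanned by `u`, `v` and `T`.
  set χ : V → Bool := fun w => decide ((w ∉ T ∧ ∃ z, H.Link T u z ∧ H.Link T w z) ∨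
    (w ∈ T ∧ E (insert u (insert v T)) w u)) with hχ
  have hd := h.distinct hT
  have hmem : ∀ w ∈ T, (χ w = true ↔ E (insert u (insert v T)) w u) := fun w hw => by
    simp [hχ, hw]
  have hnmem : ∀ w, w ∉ T → (χ w = true ↔ ∃ z, H.Link T u z ∧ H.Link T w z) := fun w hw => by
    simp [hχ, hw]
  have hfalse : ∀ w, w ∉ T → χ w = false → ∃ z, H.Link T v z ∧ H.Link T w z := fun w hw hf => by
    rcases hE.exists_link_left_or_right hH hT h hm hw with h' | h'
    · rw [(hnmem w hw).2 h'] at hf; exact absurd hf (by simp)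
    · exact h'
  -- Adjacent vertices of the same colour are joined by a walk of length four through `u` or through
  -- `v`, so they would be merged.
  have hne : ∀ w w', H.Link T w w' → χ w ≠ χ w' := by
    intro w w' hw heq
    have hd' := hw.distinct hT
    refine hE.not_merged hH hT h hm hw ?_
    cases hb : χ w
    · obtain ⟨y, hy, hy'⟩ := hfalse w hd'.2.1 hb
      obtain ⟨y1, hy1, hy1'⟩ := hfalse w' hd'.2.2 (heq ▸ hb)
      exact hE.odd_walk T hT w y v y1 w' hw hy' hy.symm hy1 hy1'.symm
    · obtain ⟨y, hy, hy'⟩ := (hnmem w hd'.2.1).1 hb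
      obtain ⟨y1, hy1, hy1'⟩ := (hnmem w' hd'.2.2).1 (heq ▸ hb)
      exact hE.odd_walk T hT w y u y1 w' hw hy' hy.symm hy1 hy1'.symm
  have hu : χ u = true := (hnmem u hd.2.1).2 ⟨v, h, h⟩
  -- the class of a vertex of `T` is described by `χ` on every edge containing `T`
  let I : V → V → Prop := fun w w' => ∀ t ∈ T, (E (insert w (insert w' T)) t w ↔ χ t = χ w)
  have hI0 : I u v := fun t ht => by rw [← hmem t ht, hu]
  have hrep : ∀ w w' y, H.Link T w w' → H.Link T w y → I w w' → I w y := by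
    intro w w' y h1 h2 hi t ht
    have d1 := h1.distinct hT
    have d2 := h2.distinct hT
    rw [← hi t ht, Finset.insert_comm w y, Finset.insert_comm w w']
    have n1 : w' ∉ insert w T := by simp [d1.1.symm, d1.2.2]
    have n2 : y ∉ insert w T := by simp [d2.1.symm, d2.2.2]
    exact ⟨hE.replace_of_mem _ y w' n2 n1 h2.symm h1.symm t (by simp [ht]) w (by simp),
      hE.replace_of_mem _ w' y n1 n2 h1.symm h2.symm t (by simp [ht]) w (by simp)⟩
  -- The ends `w`, `w'` lie in different classes and there are only two, so `t` is equivalent to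
  -- exactly one of them; the two colours behave in the same way.
  have hswap : ∀ w w', H.Link T w w' → I w w' → I w' w := by
    intro w w' h1 hi t ht
    have hnm := hE.not_merged hH hT h hm h1
    have hne' := hne w w' h1
    have hit := hi t ht
    have key : E (insert w (insert w' T)) t w' ↔ ¬ E (insert w (insert w' T)) t w := by
      constructor
      · intro ha hb
        exact hnm (hE.trans _ h1 w (by simp) t (by simp [ht]) w' (by simp)
          (hE.symm _ h1 t (by simp [ht]) w (by simp) hb) ha)
      · intro hb
        rcases hE.three _ h1 t (by simp [ht]) w (by simp) w' (by simp) with h' | h' | h'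
        · exact absurd h' hb
        · exact h'
        · exact absurd h' hnm
    rw [Finset.insert_comm, key, hit]
    revert hne'
    cases χ t <;> cases χ w <;> cases χ w' <;> simp
  -- The property travels from the edge `u v` along a path of length two to `w`.
  have hI : ∀ w w', H.Link T w w' → I w w' := by
    intro w w' h1
    rcases hE.exists_link_left_or_right hH hT h hm (h1.distinct hT).2.1 with ⟨y, hy, hy'⟩ | ⟨y, hy, hy'⟩
    · exact hrep w y w' hy' h1 (hswap y w hy'.symm (hrep y u w hy.symm hy'.symm
        (hswap u y hy (hrep u v y h hy hI0))))
    · exact hrep w y w' hy' h1 (hswap y w hy'.symm (hrep y v w hy.symm hy'.symm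
        (hswap v y hy (hrep v u y h.symm hy (hswap u v h hI0)))))
  refine ⟨χ, ⟨?_, hne⟩, hu⟩
  intro e he hTe
  obtain ⟨w, w', rfl, h1⟩ := exists_eq_insert_insert hT he hTe
  have hnm := hE.not_merged hH hT h hm h1
  have hne' := hne w w' h1
  have hw : ∀ a ∈ insert w (insert w' T), (E (insert w (insert w' T)) a w ↔ χ a = χ w) := by
    intro a ha
    rw [Finset.mem_insert, Finset.mem_insert] at ha
    rcases ha with rfl | rfl | ha
    · simpa using hE.refl _ h1 a (by simp)
    · simp only [hne'.symm, iff_false]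
      exact fun h' => hnm (hE.symm _ h1 a (by simp) w (by simp) h')
    · exact hI w w' h1 a ha
  intro a ha b hb
  have hwm : w ∈ insert w (insert w' T) := by simp
  have key : E (insert w (insert w' T)) a b ↔
      (E (insert w (insert w' T)) a w ↔ E (insert w (insert w' T)) b w) := by
    constructor
    · intro hab
      exact ⟨fun h' => hE.trans _ h1 b hb a ha w hwm (hE.symm _ h1 a ha b hb hab) h',
        fun h' => hE.trans _ h1 a ha b hb w hwm hab h'⟩
    · intro hiff
      by_cases haw : E (insert w (insert w' T)) a w
      · exact hE.trans _ h1 a ha w hwm b hb haw (hE.symm _ h1 b hb w hwm (hiff.1 haw))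
      · rcases hE.three _ h1 a ha b hb w hwm with h' | h' | h'
        · exact h'
        · exact absurd h' haw
        · exact absurd (hiff.2 h') haw
  rw [key, hw a ha, hw b hb]
  cases χ a <;> cases χ b <;> cases χ w <;> simp

theorem exists_isProper (hE : H.IsClassSystem E) (hH : H.LargeCodegree)
    (hT : T.card + 2 = r) (h : H.Link T u v) (hm : ¬ E (insert u (insert v T)) u v) (c : Bool) :
    ∃ χ : V → Bool, H.IsProper E χ T ∧ χ u = c := by
  obtain ⟨χ, hχ, hu⟩ := hE.exists_isProper_true hH hT h hm
  cases c
  · exact ⟨_, hχ.not, by simp [hu]⟩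
  · exact ⟨χ, hχ, hu⟩

/-- For a link neighbour `v` of `u`, the edge spanned by `u`, `v` and `T` also contains the new set
and has `a` and `v` in different classes. So the new set has a colouring `χ₁`, normalised at `a`,
which agrees with `χ` on this edge. At any other vertex `x` the two are compared in the link of
`insert x (T.erase a)`, whose edges are all merged or all unmerged: one edge there detects `χ x`,
another detects `χ₁ x`. -/
theorem isProper_exchange (hE : H.IsClassSystem E) (hH : H.LargeCodegree) {χ : V → Bool}
    (hT : T.card + 2 = r) (hχ : H.IsProper E χ T) {a u : V} (ha : a ∈ T) (hu : u ∉ T)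
    (hau : χ a = χ u) : H.IsProper E χ (insert u (T.erase a)) := by
  obtain ⟨v, hv⟩ := hH.exists_link hT hu
  have hd := hv.distinct hT
  have huR : u ∉ T.erase a := fun h => hu (Finset.mem_of_mem_erase h)
  have hT1 : (insert u (T.erase a)).card + 2 = r := by
    rw [Finset.card_insert_of_notMem huR, Finset.card_erase_add_one ha]; exact hT
  have comm : ∀ (x y : V) (R : Finset V), insert a (insert y (insert x R)) = insert x (insert y (insert a R)) := by
    intro x y R; ext; simp; tauto
  have heq : insert a (insert v (insert u (T.erase a))) = insert u (insert v T) := by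
    rw [comm, Finset.insert_erase ha]
  have hl : H.Link (insert u (T.erase a)) a v := by rw [Link, heq]; exact hv
  have hm : ¬ E (insert a (insert v (insert u (T.erase a)))) a v := by
    rw [heq, hχ.classes _ hv (fun t ht => by simp [ht]) a (by simp [ha]) v (by simp), hau]
    exact hχ.ne_of_link u v hv
  obtain ⟨χ₁, hχ₁, hχa⟩ := hE.exists_isProper hH hT1 hl hm (χ a)
  suffices hfun : χ₁ = χ by rwa [hfun] at hχ₁
  have hone : ∀ y ∈ insert u (insert v T), χ₁ y = χ y := by
    intro y hy
    have h1 := hχ.classes _ hv (fun t ht => by simp [ht]) y hy a (by simp [ha])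
    have h2 := hχ₁.classes _ hl (fun t ht => by
      rw [Finset.mem_insert, Finset.mem_insert]; exact Or.inr (Or.inr ht)) y (heq ▸ hy) a (by simp)
    rw [heq] at h2
    have h3 : χ y = χ a ↔ χ₁ y = χ₁ a := h1.symm.trans h2
    rw [hχa] at h3
    revert h3
    cases χ y <;> cases χ₁ y <;> cases χ a <;> simp
  funext x
  by_cases hx : x ∈ insert u (insert v T)
  · exact hone x hx
  by_contra hxne
  simp only [Finset.mem_insert, not_or] at hx
  obtain ⟨hxu, hxv, hxT⟩ := hx
  have hax : a ≠ x := fun h => hxT (h ▸ ha)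
  have hxR : x ∉ T.erase a := fun h => hxT (Finset.mem_of_mem_erase h)
  obtain ⟨y, hy⟩ := hH.exists_link hT hxT
  obtain ⟨y', hy'⟩ := hH.exists_link hT1 (u := x) (by simp [hxu, hxR])
  have hT2 : (insert x (T.erase a)).card + 2 = r := by
    rw [Finset.card_insert_of_notMem hxR, Finset.card_erase_add_one ha]; exact hT
  have e1 : insert a (insert y (insert x (T.erase a))) = insert x (insert y T) := by
    rw [comm, Finset.insert_erase ha]
  have e2 : insert u (insert y' (insert x (T.erase a))) =
      insert x (insert y' (insert u (T.erase a))) := by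
    ext; simp; tauto
  have l1 : H.Link (insert x (T.erase a)) a y := by rw [Link, e1]; exact hy
  have l2 : H.Link (insert x (T.erase a)) u y' := by rw [Link, e2]; exact hy'
  have m1 : E (insert a (insert y (insert x (T.erase a)))) a y ↔ χ a = χ y := by
    rw [e1]; exact hχ.classes _ hy (fun t ht => by simp [ht]) a (by simp [ha]) y (by simp)
  have m2 : E (insert u (insert y' (insert x (T.erase a)))) u y' ↔ χ₁ u = χ₁ y' := by
    rw [e2]
    exact hχ₁.classes _ hy' (fun t ht => by
      rw [Finset.mem_insert, Finset.mem_insert]; exact Or.inr (Or.inr ht)) u (by simp) y' (by simp)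
  have n1 := hχ.ne_of_link _ _ hy
  have n2 := hχ₁.ne_of_link _ _ hy'
  have hu1 : χ₁ u = χ u := hone u (by simp)
  have hiff : E (insert a (insert y (insert x (T.erase a)))) a y ↔
      E (insert u (insert y' (insert x (T.erase a)))) u y' := by
    constructor
    · intro h; by_contra h'; exact hE.not_merged hH hT2 l2 h' l1 h
    · intro h; by_contra h'; exact hE.not_merged hH hT2 l1 h' l2 h
  rw [m1, m2, hu1, ← hau] at hiff
  revert hiff n1 n2 hxne
  cases χ a <;> cases χ y <;> cases χ x <;> cases χ₁ y' <;> cases χ₁ x <;> simp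

end IsClassSystem

/-- The number of vertices of `S` with colour `true`. -/
def colorCount (χ : V → Bool) (S : Finset V) : ℕ :=
  (S.filter fun v => χ v = true).card

theorem colorCount_insert {χ : V → Bool} {S : Finset V} {v : V} (hv : v ∉ S) :
    colorCount χ (insert v S) = colorCount χ S + if χ v = true then 1 else 0 := by
  unfold colorCount
  rw [Finset.filter_insert]
  split_ifs with h
  · rw [Finset.card_insert_of_notMem (by simp [hv])]
  · rfl

theorem colorCount_erase {χ : V → Bool} {S : Finset V} {v : V} (hv : v ∈ S) :
    colorCount χ (S.erase v) + (if χ v = true then 1 else 0) = colorCount χ S := by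
  conv_rhs => rw [← Finset.insert_erase hv]
  rw [colorCount_insert (Finset.notMem_erase v S)]

theorem colorCount_not (χ : V → Bool) (S : Finset V) :
    colorCount (fun v => !χ v) S + colorCount χ S = S.card := by
  unfold colorCount
  rw [← Finset.card_filter_add_card_filter_not (s := S) (fun v => χ v = true), add_comm]
  congr 2
  ext; simp

theorem colorCount_le (χ : V → Bool) (S : Finset V) : colorCount χ S ≤ S.card :=
  Finset.card_filter_le _ _

theorem exists_same_color {χ : V → Bool} {T T' : Finset V} (hc : T'.card = T.card)
    (hχ : colorCount χ T' = colorCount χ T) {a : V} (ha : a ∈ T) (ha' : a ∉ T') :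
    ∃ u ∈ T', u ∉ T ∧ χ a = χ u := by
  by_contra! hcon
  have hsub : T'.filter (fun v => χ v = χ a) ⊆ T.filter (fun v => χ v = χ a) := by
    intro v hv
    rw [Finset.mem_filter] at hv ⊢
    refine ⟨?_, hv.2⟩
    by_contra hvT
    exact hcon v hv.1 hvT hv.2.symm
  have hcard : (T.filter (fun v => χ v = χ a)).card ≤ (T'.filter (fun v => χ v = χ a)).card := by
    cases hb : χ a
    · have h1 := colorCount_not χ T
      have h2 := colorCount_not χ T'
      have h3 : ∀ S, (S.filter fun v => χ v = false).card = colorCount (fun v => !χ v) S := by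
        intro S; unfold colorCount; congr 2; ext; simp
      rw [h3, h3]; omega
    · exact hχ.ge
  have heq := Finset.eq_of_subset_of_card_le hsub hcard
  have : a ∈ T'.filter (fun v => χ v = χ a) := by rw [heq]; simp [ha]
  exact ha' (Finset.mem_filter.1 this).1

/-- Vertices of equal colour are exchanged one at a time, each exchange shrinking `T \ T'`. -/
theorem IsClassSystem.isProper_of_colorCount {H : RGraph V r} {E : Finset V → V → V → Prop}
    (hE : H.IsClassSystem E) (hH : H.LargeCodegree) {χ : V → Bool} {T T' : Finset V}
    (hT : T.card + 2 = r) (hχ : H.IsProper E χ T) (hc : T'.card = T.card)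
    (hcount : colorCount χ T' = colorCount χ T) : H.IsProper E χ T' := by
  induction h : (T \ T').card generalizing T with
  | zero =>
    rw [Finset.card_eq_zero, Finset.sdiff_eq_empty_iff_subset] at h
    rwa [← Finset.eq_of_subset_of_card_le h hc.le]
  | succ n ih =>
    obtain ⟨a, ha⟩ := Finset.card_pos.1 (show 0 < (T \ T').card by omega)
    rw [Finset.mem_sdiff] at ha
    obtain ⟨u, huT', huT, hau⟩ := exists_same_color hc hcount ha.1 ha.2
    have huR : u ∉ T.erase a := fun h => huT (Finset.mem_of_mem_erase h)
    have hc1 : (insert u (T.erase a)).card = T.card := by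
      rw [Finset.card_insert_of_notMem huR, Finset.card_erase_add_one ha.1]
    refine ih (by rw [hc1]; exact hT) (hE.isProper_exchange hH hT hχ ha.1 huT hau)
      (by rw [hc1]; exact hc) ?_ ?_
    · rw [hcount, colorCount_insert huR, ← hau]
      exact (colorCount_erase ha.1).symm
    · have : insert u (T.erase a) \ T' = (T \ T').erase a := by
        ext x
        simp only [Finset.mem_sdiff, Finset.mem_insert, Finset.mem_erase]
        constructor
        · rintro ⟨rfl | h1, h2⟩
          · exact absurd huT' h2
          · exact ⟨h1.1, h1.2, h2⟩
        · rintro ⟨h1, h2, h3⟩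
          exact ⟨Or.inr ⟨h1, h2⟩, h3⟩
      rw [this, Finset.card_erase_of_mem (by simp [ha]), h]; rfl

end RGraph

/-! ### Parity of the colour counts. -/

namespace RGraph

variable {V : Type*} [Fintype V] [DecidableEq V] {r : ℕ}

/-- `χ` is proper for some, and then for every, `(r - 2)`-set with exactly `t` vertices of colour
`true`. -/
def IsPerfect (H : RGraph V r) (E : Finset V → V → V → Prop) (χ : V → Bool) (t : ℕ) : Prop :=
  ∃ T : Finset V, T.card + 2 = r ∧ colorCount χ T = t ∧ H.IsProper E χ T

namespace IsClassSystem

variable {H : RGraph V r} {E : Finset V → V → V → Prop} {χ : V → Bool} {t : ℕ}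

theorem isProper_of_isPerfect (hE : H.IsClassSystem E) (hH : H.LargeCodegree)
    (h : H.IsPerfect E χ t) {T : Finset V} (hT : T.card + 2 = r) (ht : colorCount χ T = t) :
    H.IsProper E χ T := by
  obtain ⟨T₀, hT₀, ht₀, hχ⟩ := h
  exact hE.isProper_of_colorCount hH hT₀ hχ (by omega) (by omega)

theorem isPerfect_not (h : H.IsPerfect E χ t) :
    H.IsPerfect E (fun v => !χ v) (r - 2 - t) := by
  obtain ⟨T, hT, ht, hχ⟩ := h
  refine ⟨T, hT, ?_, hχ.not⟩
  have := colorCount_not χ T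
  omega

theorem isPerfect_le (h : H.IsPerfect E χ t) : t + 2 ≤ r := by
  obtain ⟨T, hT, rfl, -⟩ := h
  have := colorCount_le χ T
  omega

/-- If `w ∉ T` has the colour other than `c`, all neighbours of `insert w T` have colour `c`. Such a
`w` exists because the ends of a link edge have different colours. -/
theorem card_color_lt (hH : H.LargeCodegree) (hr : r ≤ Fintype.card V)
    (h : H.IsPerfect E χ t) (c : Bool) :
    Fintype.card V + 3 * r < 3 * (Finset.univ.filter fun v => χ v = c).card := by
  obtain ⟨T, hT, -, hχ⟩ := h
  obtain ⟨u, hu⟩ : ∃ u, u ∉ T := by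
    by_contra! hc
    have := Finset.card_le_card (show Finset.univ ⊆ T from fun v _ => hc v)
    rw [Finset.card_univ] at this
    omega
  obtain ⟨v, hv⟩ := hH.exists_link hT hu
  have key : ∀ w, w ∉ T → χ w ≠ c →
      Fintype.card V + 3 * r < 3 * (Finset.univ.filter fun v => χ v = c).card := by
    intro w hw hwc
    refine (hH.card_lt hT hw).trans_le (Nat.mul_le_mul_left 3 (Finset.card_le_card ?_))
    intro z hz
    have := hχ.ne_of_link w z ((mem_neighbors_insert hT).1 hz)
    rw [Finset.mem_filter]
    refine ⟨Finset.mem_univ _, ?_⟩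
    revert this hwc
    cases χ w <;> cases χ z <;> cases c <;> simp
  by_cases huc : χ u = c
  · exact key v (hv.distinct hT).2.2 (huc ▸ (hχ.ne_of_link u v hv).symm)
  · exact key u hu huc

theorem false_of_same_color (hE : H.IsClassSystem E) (hH : H.LargeCodegree)
    (h : H.IsPerfect E χ t) {e : Finset V} (he : e ∈ H.edges) {p q : V} (hp : p ∈ e) (hq : q ∈ e)
    (hpq : p ≠ q) (hc : χ p = χ q) (ht : colorCount χ ((e.erase p).erase q) = t) : False := by
  obtain ⟨h1, -, h3⟩ := link_erase_erase he hp hq hpq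
  exact (hE.isProper_of_isPerfect hH h h1 ht).ne_of_link p q h3 hc

/-- Such an edge has at least two vertices of colour `false`; without them it is an `(r - 2)`-set
for which `χ` is proper, yet with a monochromatic link edge. The count `t + 2` is excluded in the
same way, with two vertices of colour `true`. -/
theorem colorCount_ne (hE : H.IsClassSystem E) (hH : H.LargeCodegree)
    (h : H.IsPerfect E χ t) {e : Finset V} (he : e ∈ H.edges) : colorCount χ e ≠ t := by
  intro ht
  have h1 := colorCount_not χ e
  rw [H.card_eq e he] at h1
  have h2 := isPerfect_le h
  obtain ⟨p, hp, q, hq, hpq⟩ := Finset.one_lt_card.1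
    (show 1 < (e.filter fun v => (!χ v) = true).card by unfold colorCount at h1 ht; beta_reduce at h1; omega)
  simp only [Bool.not_eq_eq_eq_not, Bool.not_true, Finset.mem_filter] at hp hq
  refine hE.false_of_same_color hH h he hp.1 hq.1 hpq (hp.2.trans hq.2.symm) ?_
  have h3 := colorCount_erase (χ := χ) hp.1
  have h4 := colorCount_erase (χ := χ) (Finset.mem_erase.2 ⟨hpq.symm, hq.1⟩)
  simp only [hp.2, hq.2, Bool.false_eq_true, if_false] at h3 h4
  omega

theorem colorCount_ne_add_two (hE : H.IsClassSystem E) (hH : H.LargeCodegree)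
    (h : H.IsPerfect E χ t) {e : Finset V} (he : e ∈ H.edges) : colorCount χ e ≠ t + 2 := by
  intro ht
  obtain ⟨p, hp, q, hq, hpq⟩ := Finset.one_lt_card.1
    (show 1 < (e.filter fun v => χ v = true).card by unfold colorCount at ht; omega)
  simp only [Finset.mem_filter] at hp hq
  refine hE.false_of_same_color hH h he hp.1 hq.1 hpq (hp.2.trans hq.2.symm) ?_
  have h3 := colorCount_erase (χ := χ) hp.1
  have h4 := colorCount_erase (χ := χ) (Finset.mem_erase.2 ⟨hpq.symm, hq.1⟩)
  simp only [hp.2, hq.2, if_true] at h3 h4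
  omega

theorem exists_set_of_colorCount (χ : V → Bool) (m l : ℕ)
    (hm : m ≤ (Finset.univ.filter fun v => χ v = true).card)
    (hl : l ≤ (Finset.univ.filter fun v => χ v = false).card) :
    ∃ S : Finset V, S.card = m + l ∧ colorCount χ S = m := by
  obtain ⟨A, hA, hAc⟩ := Finset.exists_subset_card_eq hm
  obtain ⟨B, hB, hBc⟩ := Finset.exists_subset_card_eq hl
  have hA' : ∀ v ∈ A, χ v = true := fun v hv => (Finset.mem_filter.1 (hA hv)).2
  have hB' : ∀ v ∈ B, χ v = false := fun v hv => (Finset.mem_filter.1 (hB hv)).2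
  have hdisj : Disjoint A B := Finset.disjoint_left.2 fun v hv hv' => by
    have := hA' v hv; rw [hB' v hv'] at this; exact absurd this (by simp)
  refine ⟨A ∪ B, by rw [Finset.card_union_of_disjoint hdisj, hAc, hBc], ?_⟩
  unfold colorCount
  rw [Finset.filter_union, Finset.filter_true_of_mem hA', Finset.filter_false_of_mem
    (fun v hv => by simp [hB' v hv]), Finset.union_empty, hAc]

theorem exists_neighbor_color (hE : H.IsClassSystem E) (hH : H.LargeCodegree)
    (h : H.IsPerfect E χ t) {S : Finset V} (ht : colorCount χ S + 1 = t) {w : V}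
    (hw : w ∈ H.neighbors S) : χ w = false := by
  rw [mem_neighbors] at hw
  by_contra hne
  refine hE.colorCount_ne hH h hw.2 ?_
  rw [colorCount_insert hw.1, if_pos (by simpa using hne), ht]

/-- In an edge with `t - 1` vertices of colour `true` the vertices of colour `false` are
equivalent. -/
theorem equiv_of_color_false (hE : H.IsClassSystem E) (hH : H.LargeCodegree)
    (hr : r ≤ Fintype.card V) (h : H.IsPerfect E χ t) {e : Finset V}
    (he : e ∈ H.edges) (ht : colorCount χ e + 1 = t) {p q : V} (hp : p ∈ e) (hq : q ∈ e)
    (hχp : χ p = false) (hχq : χ q = false) : E e p q := by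
  by_cases hpq : p = q
  · subst hpq; exact hE.refl e he p hp
  obtain ⟨h1, h2, h3⟩ := link_erase_erase he hp hq hpq
  by_contra hm
  rw [← h2] at hm
  have c1 := colorCount_erase (χ := χ) hp
  have c2 := colorCount_erase (χ := χ) (Finset.mem_erase.2 ⟨Ne.symm hpq, hq⟩)
  simp only [hχp, hχq, Bool.false_eq_true, if_false] at c1 c2
  set T := (e.erase p).erase q with hT
  obtain ⟨z, hz, hzT⟩ : ∃ z, χ z = true ∧ z ∉ T := by
    by_contra! hc
    have hlt := card_color_lt hH hr h true
    have := Finset.card_le_card (show (Finset.univ.filter fun v => χ v = true) ⊆ T from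
      fun v hv => hc v (Finset.mem_filter.1 hv).2)
    omega
  -- `T` has `t - 1` vertices of colour `true`, so a bichromatic link edge would produce the
  -- forbidden count `t`. But if `p` and `q` are unmerged, the vertex `z` of colour `true` shares a
  -- link neighbour with one of them.
  have hlink : ∀ x y, H.Link T x y → χ x = χ y := by
    intro x y hxy
    have hd := hxy.distinct h1
    have hc := hE.colorCount_ne hH h hxy
    rw [colorCount_insert (by simp [hd.1, hd.2.1]), colorCount_insert hd.2.2] at hc
    revert hc
    cases χ x <;> cases χ y <;> simp <;> omega
  rcases hE.exists_link_left_or_right hH h1 h3 hm hzT with ⟨y, hy, hy'⟩ | ⟨y, hy, hy'⟩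
  · have := (hlink _ _ hy).trans (hlink _ _ hy').symm
    rw [hχp, hz] at this
    exact absurd this (by simp)
  · have := (hlink _ _ hy).trans (hlink _ _ hy').symm
    rw [hχq, hz] at this
    exact absurd this (by simp)

theorem colorCount_exchange {T : Finset V} {χ : V → Bool} {u m : V} (hu : u ∈ T) (hm : m ∉ T)
    (c : χ u = χ m) : colorCount χ (insert m (T.erase u)) = colorCount χ T := by
  rw [colorCount_insert (fun h => hm (Finset.mem_of_mem_erase h)), ← c, colorCount_erase hu]

/-- Take an edge `e` with `t - 1` vertices of colour `true`. Its vertices of colour `false` are all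
equivalent, so a vertex `p` of the other class has colour `true`. Removing `p` and a vertex `w` of
colour `false` leaves a set `T` with `t - 2` vertices of colour `true` and an unmerged link edge.
Its colouring `ψ` turns out to be `χ`. -/
theorem isPerfect_sub_two (hE : H.IsClassSystem E) (hH : H.LargeCodegree)
    (hr : r ≤ Fintype.card V) (h : H.IsPerfect E χ t) (ht : 1 ≤ t) :
    2 ≤ t ∧ H.IsPerfect E χ (t - 2) := by
  have htr := isPerfect_le h
  have hPt := card_color_lt hH hr h true
  have hPf := card_color_lt hH hr h false
  obtain ⟨S, hS, hSt⟩ := exists_set_of_colorCount χ (t - 1) (r - t) (by omega) (by omega)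
  obtain ⟨w, hw⟩ := Finset.card_pos.1
    (show 0 < (H.neighbors S).card by have := hH S (by omega); omega)
  have hwf := hE.exists_neighbor_color hH h (by omega) hw
  rw [mem_neighbors] at hw
  set e := insert w S with he
  have hec : colorCount χ e + 1 = t := by
    rw [he, colorCount_insert hw.1, hwf]; simp; omega
  have hwe : w ∈ e := by simp [he]
  obtain ⟨p, hp, hpw⟩ : ∃ p ∈ e, ¬ E e p w := by
    obtain ⟨a, ha, b, hb, hab⟩ := hE.nontrivial e hw.2
    by_contra! hc
    exact hab (hE.trans e hw.2 a ha w hwe b hb (hc a ha) (hE.symm e hw.2 b hb w hwe (hc b hb)))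
  have hχp : χ p = true := by
    by_contra hne
    exact hpw (hE.equiv_of_color_false hH hr h hw.2 hec hp hwe (by simpa using hne) hwf)
  have hpne : p ≠ w := by rintro rfl; rw [hwf] at hχp; exact absurd hχp (by simp)
  obtain ⟨hT, hTe, hl⟩ := link_erase_erase hw.2 hp hwe hpne
  have c1 := colorCount_erase (χ := χ) hp
  have c2 := colorCount_erase (χ := χ) (Finset.mem_erase.2 ⟨Ne.symm hpne, hwe⟩)
  simp only [hχp, hwf, Bool.false_eq_true, if_false, if_true] at c1 c2
  have hte : (e.erase p).erase w ⊆ e := fun x hx =>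
    Finset.mem_of_mem_erase (Finset.mem_of_mem_erase hx)
  have hpT : p ∉ (e.erase p).erase w := by simp
  have hwT : w ∉ (e.erase p).erase w := by simp
  set T := (e.erase p).erase w with hTdef
  have ht2 : 2 ≤ t := by omega
  have hcT : colorCount χ T + 2 = t := by omega
  refine ⟨ht2, ?_⟩
  obtain ⟨ψ, hψ, hψp⟩ := hE.exists_isProper hH hT hl (by rwa [hTe]) true
  have hψw : ψ w = false := by
    have := hψ.ne_of_link p w hl
    rw [hψp] at this
    simpa using this.symm
  have hψperf : H.IsPerfect E ψ (colorCount ψ T) := ⟨T, hT, rfl, hψ⟩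
  have hψe : ∀ x ∈ e, χ x = false → ψ x = false := by
    intro x hx hxf
    rw [← hψw]
    exact (hψ.classes e hw.2 hte x hx w hwe).1
      (hE.equiv_of_color_false hH hr h hw.2 hec hx hwe hxf hwf)
  have hnb : ∀ x, χ x = true → x ∉ T → ∀ y ∈ H.neighbors (insert x T), χ y = false := by
    intro x hx hxT y hy
    refine hE.exists_neighbor_color hH h ?_ hy
    rw [colorCount_insert hxT, hx]; simp; omega
  -- Both neighbourhoods avoid the `χ`-`true` vertices, a set of more than a third of `V`; so `x`
  -- and `p` have a common link neighbour and hence the same `ψ`-colour.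
  have hψP : ∀ x, χ x = true → x ∉ T → ψ x = true := by
    intro x hx hxT
    by_contra hxf
    have hxf : ψ x = false := by simpa using hxf
    have k1 := hH.card_lt hT hxT
    have k2 := hH.card_lt hT hpT
    rcases exists_mem_two_of_card (A := H.neighbors (insert x T))
      (B := H.neighbors (insert p T)) (C := Finset.univ.filter fun v => χ v = true) (by omega) with
      ⟨z, hz, hz'⟩ | ⟨z, hz, hz'⟩ | ⟨z, hz, hz'⟩
    · have n1 := hψ.ne_of_link _ _ ((mem_neighbors_insert hT).1 hz)
      have n2 := hψ.ne_of_link _ _ ((mem_neighbors_insert hT).1 hz')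
      rw [hxf] at n1; rw [hψp] at n2
      revert n1 n2; cases ψ z <;> simp
    · have := hnb x hx hxT z hz
      rw [(Finset.mem_filter.1 hz').2] at this; exact absurd this (by simp)
    · have := hnb p hχp hpT z hz
      rw [(Finset.mem_filter.1 hz').2] at this; exact absurd this (by simp)
  -- an `(r - 1)`-set all of whose neighbours have `χ = false` and `ψ = true` cannot exist
  have hcontra : ∀ u ∈ T, ∀ m, m ∉ T → m ≠ p → ψ u = false → ψ m = true → χ u = χ m → False := by
    intro u hu m hm hmp hψu hψm hum
    have hmR : m ∉ T.erase u := fun h' => hm (Finset.mem_of_mem_erase h')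
    have hpS : p ∉ insert m (T.erase u) := by
      rw [Finset.mem_insert, not_or]
      exact ⟨hmp.symm, fun h' => hpT (Finset.mem_of_mem_erase h')⟩
    have hScard : (insert p (insert m (T.erase u))).card + 1 = r := by
      rw [Finset.card_insert_of_notMem hpS, Finset.card_insert_of_notMem hmR,
        Finset.card_erase_add_one hu]
      omega
    have hSχ : colorCount χ (insert p (insert m (T.erase u))) + 1 = t := by
      rw [colorCount_insert hpS, colorCount_exchange hu hm hum, hχp]; simp; omega
    have hSψ : colorCount ψ (insert p (insert m (T.erase u))) = colorCount ψ T + 2 := by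
      have := colorCount_erase (χ := ψ) hu
      rw [hψu] at this
      rw [colorCount_insert hpS, colorCount_insert hmR, hψm, hψp]
      simp at this ⊢; omega
    -- The three sets below are pairwise disjoint, each of size above `|V| / 3`; the slack `3 * r`
    -- pays for removing `T` from the last one.
    have k1 := hH _ hScard
    have k2 := card_color_lt hH hr hψperf false
    have k3 := Finset.le_card_sdiff T (Finset.univ.filter fun v => χ v = true)
    rcases exists_mem_two_of_card (A := H.neighbors (insert p (insert m (T.erase u))))
      (B := Finset.univ.filter fun v => ψ v = false)
      (C := (Finset.univ.filter fun v => χ v = true) \ T) (by omega) with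
      ⟨z, hz, hz'⟩ | ⟨z, hz, hz'⟩ | ⟨z, hz, hz'⟩
    · have hzf := (Finset.mem_filter.1 hz').2
      rw [mem_neighbors] at hz
      refine hE.colorCount_ne_add_two hH hψperf hz.2 ?_
      rw [colorCount_insert hz.1, hSψ, hzf]; simp
    · have := hE.exists_neighbor_color hH h hSχ hz
      simp [this] at hz'
    · simp only [Finset.mem_sdiff, Finset.mem_filter, Finset.mem_univ, true_and] at hz hz'
      have := hψP z hz'.1 hz'.2
      rw [hz] at this; exact absurd this (by simp)
  -- A disagreement inside `T` serves as `u`, with a fresh `χ`-`true` vertex as `m`; a disagreement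
  -- outside `T` serves as `m`, with a `χ`-`false` vertex of `T` as `u`.
  have hfun : ψ = χ := by
    funext x
    by_contra hne
    by_cases hxT : x ∈ T
    · have hχx : χ x = true := by
        by_contra hc
        have hc : χ x = false := by simpa using hc
        exact hne ((hψe x (hte hxT) hc).trans hc.symm)
      have hψx : ψ x = false := by
        rw [hχx] at hne; simpa using hne
      obtain ⟨m, hm, hmT⟩ : ∃ m, χ m = true ∧ m ∉ insert p T := by
        by_contra! hc
        have := Finset.card_le_card (show (Finset.univ.filter fun v => χ v = true) ⊆ insert p T from
          fun v hv => hc v (Finset.mem_filter.1 hv).2)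
        rw [Finset.card_insert_of_notMem hpT] at this
        omega
      rw [Finset.mem_insert, not_or] at hmT
      exact hcontra x hxT m hmT.2 hmT.1 hψx (hψP m hm hmT.2) (hχx.trans hm.symm)
    · have hχx : χ x = false := by
        by_contra hc
        have hc : χ x = true := by simpa using hc
        exact hne ((hψP x hc hxT).trans hc.symm)
      have hψx : ψ x = true := by
        rw [hχx] at hne; simpa using hne
      obtain ⟨u, hu⟩ := Finset.card_pos.1
        (show 0 < (T.filter fun v => (!χ v) = true).card by
          have := colorCount_not χ T
          unfold colorCount at this hcT
          beta_reduce at this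
          omega)
      simp only [Bool.not_eq_eq_eq_not, Bool.not_true, Finset.mem_filter] at hu
      refine hcontra u hu.1 x hxT ?_ (hψe u (hte hu.1) hu.2) hψx (hu.2.trans hχx.symm)
      rintro rfl
      rw [hχp] at hχx; exact absurd hχx (by simp)
  subst hfun
  exact ⟨T, hT, by omega, hψ⟩

theorem even_of_isPerfect (hE : H.IsClassSystem E) (hH : H.LargeCodegree)
    (hr : r ≤ Fintype.card V) (h : H.IsPerfect E χ t) : Even t := by
  induction t using Nat.strong_induction_on with
  | _ t ih =>
    rcases Nat.eq_zero_or_pos t with rfl | ht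
    · exact ⟨0, rfl⟩
    · obtain ⟨h2, hp⟩ := hE.isPerfect_sub_two hH hr h ht
      have := ih (t - 2) (by omega) hp
      rw [show t = t - 2 + 2 by omega]
      exact this.add (by decide)

theorem isPerfect_of_even_le (hE : H.IsClassSystem E) (hH : H.LargeCodegree)
    (hr : r ≤ Fintype.card V) (h : H.IsPerfect E χ t) {s : ℕ} (hs : Even s) (hst : s ≤ t) :
    H.IsPerfect E χ s := by
  have ht := hE.even_of_isPerfect hH hr h
  obtain ⟨m, hm⟩ : ∃ m, t = s + 2 * m := by
    obtain ⟨a, rfl⟩ := hs; obtain ⟨b, rfl⟩ := ht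
    exact ⟨b - a, by omega⟩
  induction m generalizing t with
  | zero => simpa [hm] using h
  | succ m ih =>
    obtain ⟨h2, hp⟩ := hE.isPerfect_sub_two hH hr h (by omega)
    exact ih hp (by omega) (hE.even_of_isPerfect hH hr hp) (by omega)

/-- Both `t` and `r - 2 - t` are even, so `r` is even and `d < r`. Descending to `0`, complementing
the colours to get `r - 2`, and descending again reaches `d - 1`; a link edge then adds one vertex
of each colour. -/
theorem exists_edge_colorCount_eq (hE : H.IsClassSystem E) (hH : H.LargeCodegree)
    (hr2 : 2 ≤ r) (hr : r ≤ Fintype.card V) {d : ℕ} (hd : Odd d) (hdr : d ≤ r) :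
    ∃ χ : V → Bool, ∃ e ∈ H.edges, colorCount χ e = d ∧
      ∀ a ∈ e, ∀ b ∈ e, (E e a b ↔ χ a = χ b) := by
  obtain ⟨S, -, hS⟩ := Finset.exists_subset_card_eq
    (show r - 1 ≤ (Finset.univ : Finset V).card by rw [Finset.card_univ]; omega)
  obtain ⟨w, hw⟩ := Finset.card_pos.1
    (show 0 < (H.neighbors S).card by have := hH S (by omega); omega)
  rw [mem_neighbors] at hw
  obtain ⟨a, ha, b, hb, hab⟩ := hE.nontrivial _ hw.2
  have hne : a ≠ b := by rintro rfl; exact hab (hE.refl _ hw.2 a ha)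
  obtain ⟨hT, hTe, hl⟩ := link_erase_erase hw.2 ha hb hne
  obtain ⟨χ, hχ, -⟩ := hE.exists_isProper hH hT hl (by rwa [hTe]) true
  have h1 : H.IsPerfect E χ _ := ⟨_, hT, rfl, hχ⟩
  have e1 := hE.even_of_isPerfect hH hr h1
  have e2 := hE.even_of_isPerfect hH hr (isPerfect_not h1)
  have hle := isPerfect_le h1
  have hreven : Even r := by
    have := (e1.add e2).add (show Even 2 by decide)
    rwa [show ∀ c, c + 2 ≤ r → c + (r - 2 - c) + 2 = r from fun c hc => by omega] at this
    exact hle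
  have h0 := hE.isPerfect_of_even_le hH hr h1 (s := 0) ⟨0, rfl⟩ (Nat.zero_le _)
  have hd' : d ≠ r := by
    rintro rfl
    exact (Nat.not_even_iff_odd.2 hd) hreven
  have hdpos := hd.pos
  obtain ⟨T, hT', hcT, hψ⟩ := hE.isPerfect_of_even_le hH hr (isPerfect_not h0) (s := d - 1)
    (by obtain ⟨m, rfl⟩ := hd; simp) (by omega)
  obtain ⟨u, hu⟩ : ∃ u, u ∉ T := by
    by_contra! hc
    have := Finset.card_le_card (show Finset.univ ⊆ T from fun v _ => hc v)
    rw [Finset.card_univ] at this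
    omega
  obtain ⟨v, hv⟩ := hH.exists_link hT' hu
  have hdist := hv.distinct hT'
  refine ⟨_, _, hv, ?_, hψ.classes _ hv (fun t ht => by simp [ht])⟩
  rw [colorCount_insert (by simp [hdist.1, hdist.2.1]), colorCount_insert hdist.2.2, hcT]
  have := hψ.ne_of_link u v hv
  revert this
  cases χ u <;> cases χ v <;> simp <;> omega

end IsClassSystem

end RGraph

/-! ### Ordered edges and exchanges of their entries. -/

namespace RGraph

variable {V ι : Type*} [Fintype V] [DecidableEq V] [Fintype ι] [DecidableEq ι] {r : ℕ}

/-- `x` enumerates the vertices of an edge of `H`. -/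
def IsOrdering (H : RGraph V r) (x : ι → V) : Prop :=
  Finset.univ.image x ∈ H.edges

/-- `x` and `y` are ordered edges of `H` that agree outside at most one position. -/
def Step (H : RGraph V r) (x y : ι → V) : Prop :=
  H.IsOrdering x ∧ H.IsOrdering y ∧ ∃ i v, y = Function.update x i v

/-- The ordered edge `y` is reached from `x` by `n` steps. -/
def Reach (H : RGraph V r) : ℕ → (ι → V) → (ι → V) → Prop
  | 0, x, y => x = y
  | n + 1, x, y => ∃ z, Reach H n x z ∧ H.Step z y

/-- Exchanging the entries of `x` at `i` and `j` takes `n` steps. -/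
def SwapReach (H : RGraph V r) (n : ℕ) (x : ι → V) (i j : ι) : Prop :=
  H.Reach n x (x ∘ Equiv.swap i j)

variable {H : RGraph V r} {x y z : ι → V} {i j k : ι} {m n : ℕ}

theorem IsOrdering.injective (hι : Fintype.card ι = r) (hx : H.IsOrdering x) :
    Function.Injective x := by
  have := H.card_eq _ hx
  rwa [← hι, ← Finset.card_univ, Finset.card_image_iff, Finset.coe_univ, Set.injOn_univ] at this

theorem image_comp_perm (x : ι → V) (σ : Equiv.Perm ι) :
    Finset.univ.image (x ∘ σ) = Finset.univ.image x := by
  rw [← Finset.image_image, Finset.image_univ_of_surjective σ.surjective]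

theorem IsOrdering.comp (hx : H.IsOrdering x) (σ : Equiv.Perm ι) : H.IsOrdering (x ∘ σ) := by
  unfold IsOrdering
  rwa [image_comp_perm]

theorem Step.symm (h : H.Step x y) : H.Step y x := by
  obtain ⟨hx, hy, i, v, rfl⟩ := h
  exact ⟨hy, hx, i, x i, by simp⟩

theorem Step.comp (h : H.Step x y) (σ : Equiv.Perm ι) : H.Step (x ∘ σ) (y ∘ σ) := by
  obtain ⟨hx, hy, i, v, rfl⟩ := h
  exact ⟨hx.comp σ, hy.comp σ, σ.symm i, v, Function.update_comp_equiv x σ i v⟩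

theorem Reach.comp (h : H.Reach n x y) (σ : Equiv.Perm ι) : H.Reach n (x ∘ σ) (y ∘ σ) := by
  induction n generalizing y with
  | zero => exact congrArg (· ∘ σ) h
  | succ n ih =>
    obtain ⟨z, hz, hs⟩ := h
    exact ⟨z ∘ σ, ih hz, hs.comp σ⟩

theorem Reach.trans (h : H.Reach m x y) (h' : H.Reach n y z) : H.Reach (m + n) x z := by
  induction n generalizing z with
  | zero => exact h' ▸ h
  | succ n ih =>
    obtain ⟨w, hw, hs⟩ := h'
    exact ⟨w, ih hw, hs⟩

theorem Step.reach (h : H.Step x y) : H.Reach 1 x y := ⟨x, rfl, h⟩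

theorem Reach.symm (h : H.Reach n x y) : H.Reach n y x := by
  induction n generalizing y with
  | zero => exact Eq.symm h
  | succ n ih =>
    obtain ⟨w, hw, hs⟩ := h
    rw [add_comm]
    exact hs.symm.reach.trans (ih hw)

theorem Reach.refl [Nonempty ι] (hx : H.IsOrdering x) (n : ℕ) : H.Reach n x x := by
  induction n with
  | zero => rfl
  | succ n ih =>
    obtain ⟨i⟩ := ‹Nonempty ι›
    exact ⟨x, ih, hx, hx, i, x i, by simp⟩

theorem Reach.mono [Nonempty ι] (hx : H.IsOrdering x) (h : H.Reach m x y) (hmn : m ≤ n) :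
    H.Reach n x y := by
  obtain ⟨l, rfl⟩ := Nat.exists_eq_add_of_le hmn
  rw [add_comm]
  exact (Reach.refl hx l).trans h

theorem SwapReach.comm (h : H.SwapReach n x i j) : H.SwapReach n x j i := by
  rwa [SwapReach, Equiv.swap_comm]

theorem SwapReach.refl [Nonempty ι] (hx : H.IsOrdering x) (n : ℕ) (i : ι) :
    H.SwapReach n x i i := by
  rw [SwapReach, Equiv.swap_self]
  exact Reach.refl hx n

theorem SwapReach.mono [Nonempty ι] (hx : H.IsOrdering x) (h : H.SwapReach m x i j)
    (hmn : m ≤ n) : H.SwapReach n x i j :=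
  Reach.mono hx h hmn

theorem SwapReach.of_reach (h : H.SwapReach m x i j) (hxy : H.Reach n x y) :
    H.SwapReach (n + m + n) y i j :=
  (hxy.symm.trans h).trans (hxy.comp _)

/-- The transposition `(i k)` is the conjugate `(i j)(j k)(i j)`, hence the cost `2 * m + n`. -/
theorem SwapReach.trans [Nonempty ι] (hx : H.IsOrdering x) (h : H.SwapReach m x i j)
    (h' : H.SwapReach n x j k) : H.SwapReach (2 * m + n) x i k := by
  by_cases hij : i = j
  · subst hij; exact h'.mono hx (by omega)
  by_cases hik : i = k
  · subst hik; exact .refl hx _ _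
  by_cases hjk : j = k
  · subst hjk; exact h.mono hx (by omega)
  have key : Equiv.swap i k = Equiv.swap i j * Equiv.swap j k * Equiv.swap i j := by
    rw [Equiv.swap_comm i j, Equiv.swap_comm j k,
      Equiv.swap_mul_swap_mul_swap (Ne.symm hjk) (Ne.symm hik)]
  have h1 : H.Reach m (x ∘ Equiv.swap i j) ((x ∘ Equiv.swap i j) ∘ Equiv.swap i j) := Reach.comp h _
  have h2 : H.Reach n (x ∘ Equiv.swap i j) ((x ∘ Equiv.swap j k) ∘ Equiv.swap i j) := Reach.comp h' _
  have h3 : H.Reach m ((x ∘ Equiv.swap j k) ∘ Equiv.swap i j)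
      (((x ∘ Equiv.swap i j) ∘ Equiv.swap j k) ∘ Equiv.swap i j) :=
    Reach.comp (Reach.comp h (Equiv.swap j k)) (Equiv.swap i j)
  have h4 := (Reach.trans h h2).trans h3
  rw [SwapReach, key]
  rwa [show m + n + m = 2 * m + n by ring] at h4

/-- Multiplying `σ` by `swap i (σ i)` shrinks its support and keeps it inside the classes of `R`, so
at most `Fintype.card ι` exchanges are needed. -/
theorem reach_comp_perm [Nonempty ι] (hx : H.IsOrdering x) {R : ι → ι → Prop}
    (hsymm : ∀ i j, R i j → R j i) (htrans : ∀ i j k, R i j → R j k → R i k)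
    (hR : ∀ i j, R i j → H.SwapReach n x i j) (σ : Equiv.Perm ι) (hσ : ∀ i, R i (σ i)) :
    H.Reach (n * Fintype.card ι) x (x ∘ σ) := by
  suffices h : ∀ m, ∀ σ : Equiv.Perm ι, (∀ i, R i (σ i)) → σ.support.card ≤ m →
      H.Reach (n * m) x (x ∘ σ) from h _ σ hσ (Finset.card_le_univ _)
  intro m
  induction m with
  | zero =>
    intro σ _ hc
    rw [Nat.le_zero, Finset.card_eq_zero, Equiv.Perm.support_eq_empty_iff] at hc
    subst hc; rfl
  | succ m ih =>
    intro σ hσ hc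
    by_cases hσ1 : σ = 1
    · subst hσ1; exact Reach.refl hx _
    obtain ⟨i, hi⟩ : ∃ i, σ i ≠ i := by
      by_contra! hcon; exact hσ1 (Equiv.ext hcon)
    have hrefl : ∀ i, R i i := fun i => htrans _ _ _ (hσ i) (hsymm _ _ (hσ i))
    have hτ : ∀ a, R a ((Equiv.swap i (σ i) * σ) a) := by
      intro a
      rw [Equiv.Perm.mul_apply]
      by_cases h1 : σ a = i
      · rw [h1, Equiv.swap_apply_left]
        exact htrans _ _ _ (h1 ▸ hσ a) (hσ i)
      · by_cases h2 : σ a = σ i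
        · rw [h2, Equiv.swap_apply_right, σ.injective h2]; exact hrefl i
        · rw [Equiv.swap_apply_of_ne_of_ne h1 h2]; exact hσ a
    have h1 := ih _ hτ (by have := Equiv.Perm.card_support_swap_mul hi; omega)
    have h2 := Reach.comp (hR i (σ i) (hσ i)) (Equiv.swap i (σ i) * σ)
    have h3 : (x ∘ Equiv.swap i (σ i)) ∘ (Equiv.swap i (σ i) * σ : Equiv.Perm ι) = x ∘ σ := by
      ext a; simp
    rw [h3] at h2
    exact h1.trans h2

theorem image_update (x : ι → V) (i : ι) (v : V) :
    Finset.univ.image (Function.update x i v) = insert v ((Finset.univ.erase i).image x) := by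
  conv_lhs => rw [← Finset.insert_erase (Finset.mem_univ i)]
  rw [Finset.image_insert, Function.update_self]
  congr 1
  exact Finset.image_congr fun a ha => Function.update_of_ne (Finset.ne_of_mem_erase ha) _ _

theorem image_update_update (x : ι → V) (hij : i ≠ j) (p q : V) :
    Finset.univ.image (Function.update (Function.update x i p) j q) =
      insert p (insert q (((Finset.univ.erase i).erase j).image x)) := by
  rw [image_update]
  have : Finset.univ.erase j = insert i ((Finset.univ.erase i).erase j) := by
    rw [Finset.erase_right_comm, Finset.insert_erase]; simp [hij]
  rw [this, Finset.image_insert, Function.update_self, Finset.insert_comm]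
  congr 2
  refine Finset.image_congr fun a ha => Function.update_of_ne ?_ _ _
  exact Finset.ne_of_mem_erase (Finset.mem_of_mem_erase ha)

theorem card_image_erase_erase (hι : Fintype.card ι = r) (hx : H.IsOrdering x) (hij : i ≠ j) :
    (((Finset.univ.erase i).erase j).image x).card + 2 = r := by
  rw [Finset.card_image_of_injective _ (hx.injective hι), Finset.card_erase_of_mem
    (by simp [hij.symm]), Finset.card_erase_of_mem (Finset.mem_univ _), Finset.card_univ, hι]
  have := Fintype.one_lt_card_iff.2 ⟨i, j, hij⟩
  omega

theorem image_eq_insert_insert (x : ι → V) (hij : i ≠ j) :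
    Finset.univ.image x =
      insert (x i) (insert (x j) (((Finset.univ.erase i).erase j).image x)) := by
  have := image_update_update x hij (x i) (x j)
  simpa using this

/-- With `u = x i` and `v = x j`, the entries at `i`, `j` run through `(u, v)`, `(u, s)`, `(w, s)`,
`(w, t)`, `(v, t)`, `(v, u)`: a closed walk of length five in the link graph. -/
theorem swapReach_of_walk (hij : i ≠ j) {s w t : V}
    (h0 : H.Link (((Finset.univ.erase i).erase j).image x) (x i) (x j))
    (h1 : H.Link (((Finset.univ.erase i).erase j).image x) (x i) s)
    (h2 : H.Link (((Finset.univ.erase i).erase j).image x) s w)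
    (h3 : H.Link (((Finset.univ.erase i).erase j).image x) w t)
    (h4 : H.Link (((Finset.univ.erase i).erase j).image x) t (x j)) :
    H.SwapReach 5 x i j := by
  have hord : ∀ p q, H.Link (((Finset.univ.erase i).erase j).image x) p q →
      H.IsOrdering (Function.update (Function.update x i p) j q) := fun p q h => by
    rw [IsOrdering, image_update_update x hij]; exact h
  have stepr : ∀ p q q', H.Link (((Finset.univ.erase i).erase j).image x) p q →
      H.Link (((Finset.univ.erase i).erase j).image x) p q' →
      H.Step (Function.update (Function.update x i p) j q)
        (Function.update (Function.update x i p) j q') := fun p q q' h h' =>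
    ⟨hord _ _ h, hord _ _ h', j, q', by simp⟩
  have stepl : ∀ p p' q, H.Link (((Finset.univ.erase i).erase j).image x) p q →
      H.Link (((Finset.univ.erase i).erase j).image x) p' q →
      H.Step (Function.update (Function.update x i p) j q)
        (Function.update (Function.update x i p') j q) := fun p p' q h h' =>
    ⟨hord _ _ h, hord _ _ h', i, p', by
      rw [Function.update_comm hij, Function.update_comm hij, Function.update_idem]⟩
  have hstart : Function.update (Function.update x i (x i)) j (x j) = x := by simp
  have hend : Function.update (Function.update x i (x j)) j (x i) = x ∘ Equiv.swap i j := by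
    ext a
    by_cases ha : a = j
    · subst ha; simp
    · rw [Function.update_of_ne ha]
      by_cases ha' : a = i
      · subst ha'; simp
      · rw [Function.update_of_ne ha']; simp [Equiv.swap_apply_of_ne_of_ne ha' ha]
  have s1 := (stepr _ _ _ h0 h1).reach
  have s2 := (stepl _ _ _ h1 h2.symm).reach
  have s3 := (stepr _ _ _ h2.symm h3).reach
  have s4 := (stepl _ _ _ h3 h4.symm).reach
  have s5 := (stepr _ _ _ h4.symm h0.symm).reach
  have := (((s1.trans s2).trans s3).trans s4).trans s5
  rwa [hstart, hend] at this

theorem swapReach_of_common (hι : Fintype.card ι = r) (hx : H.IsOrdering x) (hij : i ≠ j)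
    {v : V} (h1 : v ∈ H.neighbors ((Finset.univ.erase i).image x))
    (h2 : v ∈ H.neighbors ((Finset.univ.erase j).image x)) : H.SwapReach 5 x i j := by
  have hc := card_image_erase_erase hι hx hij
  have e1 : (Finset.univ.erase i).image x =
      insert (x j) (((Finset.univ.erase i).erase j).image x) := by
    rw [← Finset.image_insert, Finset.insert_erase (by simp [hij.symm])]
  have e2 : (Finset.univ.erase j).image x =
      insert (x i) (((Finset.univ.erase i).erase j).image x) := by
    rw [← Finset.image_insert, Finset.erase_right_comm, Finset.insert_erase (by simp [hij])]
  rw [e1, mem_neighbors_insert hc] at h1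
  rw [e2, mem_neighbors_insert hc] at h2
  have h0 : H.Link (((Finset.univ.erase i).erase j).image x) (x i) (x j) := by
    rw [Link, ← image_eq_insert_insert x hij]; exact hx
  exact swapReach_of_walk hij h0 h2 h2.symm h2 h1.symm

theorem LargeCodegree.swapReach_three [Nonempty ι] (hH : H.LargeCodegree)
    (hι : Fintype.card ι = r) (hx : H.IsOrdering x) (i j k : ι) :
    H.SwapReach 5 x i j ∨ H.SwapReach 5 x i k ∨ H.SwapReach 5 x j k := by
  by_cases hij : i = j
  · subst hij; exact Or.inl (.refl hx _ _)
  by_cases hik : i = k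
  · subst hik; exact Or.inr (Or.inl (.refl hx _ _))
  by_cases hjk : j = k
  · subst hjk; exact Or.inr (Or.inr (.refl hx _ _))
  have hd : ∀ a : ι, Fintype.card V + 3 * r <
      3 * (H.neighbors ((Finset.univ.erase a).image x)).card := fun a => by
    refine hH _ ?_
    rw [Finset.card_image_of_injective _ (hx.injective hι),
      Finset.card_erase_add_one (Finset.mem_univ _), Finset.card_univ, hι]
  have h1 := hd i
  have h2 := hd j
  have h3 := hd k
  rcases exists_mem_two_of_card (A := H.neighbors ((Finset.univ.erase i).image x))
    (B := H.neighbors ((Finset.univ.erase j).image x))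
    (C := H.neighbors ((Finset.univ.erase k).image x)) (by omega) with
    ⟨v, hv, hv'⟩ | ⟨v, hv, hv'⟩ | ⟨v, hv, hv'⟩
  · exact Or.inl (swapReach_of_common hι hx hij hv hv')
  · exact Or.inr (Or.inl (swapReach_of_common hι hx hik hv hv'))
  · exact Or.inr (Or.inr (swapReach_of_common hι hx hjk hv hv'))

theorem exists_perm_of_image_eq (hy : Function.Injective y)
    (h : Finset.univ.image y = Finset.univ.image x) : ∃ σ : Equiv.Perm ι, y = x ∘ σ := by
  have hf : ∀ a, ∃ b, x b = y a := fun a => by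
    have : y a ∈ Finset.univ.image x := by rw [← h]; simp
    simpa using this
  choose f hf using hf
  have hinj : Function.Injective f := fun a b hab => hy (by rw [← hf, ← hf, hab])
  exact ⟨Equiv.ofBijective f (Finite.injective_iff_bijective.1 hinj), by ext a; simp [hf]⟩

/-- Two vertices of the edge `e` are equivalent if they can be exchanged in at most five steps. -/
def Exchangeable (ι : Type*) [Fintype ι] [DecidableEq ι] (H : RGraph V r) (e : Finset V)
    (u v : V) : Prop :=
  ∃ x : ι → V, Finset.univ.image x = e ∧ ∃ i j, x i = u ∧ x j = v ∧ H.SwapReach 5 x i j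

/-- Permuting positions commutes with steps, so the choice of the ordering of the edge does not
matter. -/
theorem exchangeable_iff (hι : Fintype.card ι = r) (hx : H.IsOrdering x) {i j : ι} :
    H.Exchangeable ι (Finset.univ.image x) (x i) (x j) ↔ H.SwapReach 5 x i j := by
  constructor
  · rintro ⟨y, hyx, a, b, ha, hb, h⟩
    have hy : H.IsOrdering y := by rw [IsOrdering, hyx]; exact hx
    obtain ⟨σ, rfl⟩ := exists_perm_of_image_eq (hy.injective hι) hyx
    have hai : σ a = i := hx.injective hι ha
    have hbj : σ b = j := hx.injective hι hb
    have h1 := Reach.comp h σ⁻¹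
    have e1 : (x ∘ σ) ∘ (σ⁻¹ : Equiv.Perm ι) = x := by ext; simp
    have e2 : ((x ∘ σ) ∘ Equiv.swap a b) ∘ (σ⁻¹ : Equiv.Perm ι) = x ∘ Equiv.swap i j := by
      rw [← hai, ← hbj]
      ext c
      simp only [Function.comp_apply]
      congr 1
      rw [Equiv.swap_apply_apply]; rfl
    rwa [e1, e2] at h1
  · intro h
    exact ⟨x, rfl, i, j, rfl, rfl, h⟩

theorem exists_ordering (hι : Fintype.card ι = r) {e : Finset V} (he : e ∈ H.edges) :
    ∃ x : ι → V, Finset.univ.image x = e := by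
  have hc : Fintype.card ι = Fintype.card e := by rw [hι, Fintype.card_coe, H.card_eq e he]
  obtain ⟨f⟩ := Fintype.card_eq.1 hc
  refine ⟨fun i => f i, ?_⟩
  ext v
  simp only [Finset.mem_image, Finset.mem_univ, true_and]
  constructor
  · rintro ⟨i, rfl⟩; exact (f i).2
  · intro hv; exact ⟨f.symm ⟨v, hv⟩, by simp⟩

/-- No ordered edge `x` reaches `x ∘ c` within `35 * r` steps. -/
def Avoids (H : RGraph V r) (c : Equiv.Perm ι) : Prop :=
  ∀ x : ι → V, H.IsOrdering x → ¬ H.Reach (35 * r) x (x ∘ c)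

variable {c : Equiv.Perm ι}

theorem Avoids.not_forall_swapReach [Nonempty ι] (hc : H.Avoids c) (hι : Fintype.card ι = r)
    (hx : H.IsOrdering x) (h : ∀ i j, H.SwapReach 35 x i j) : False := by
  have := reach_comp_perm hx (R := fun _ _ => True) (by simp) (by simp) (fun i j _ => h i j) c
    (by simp)
  rw [hι] at this
  exact hc x hx this

/-- If `i` and `j` swap in 15 steps but not in 5, every position swaps in 5 steps with `i` or with
`j`. Chaining through both costs at most `2 * 5 + (2 * 5 + 15) = 35`, so every transposition, and
hence `c`, would be reachable. This gap between 5 and 15 is what makes exchangeability transitive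
and invariant under steps. -/
theorem Avoids.swapReach_five [Nonempty ι] (hc : H.Avoids c) (hH : H.LargeCodegree)
    (hι : Fintype.card ι = r) (hx : H.IsOrdering x) (h : H.SwapReach 15 x i j) :
    H.SwapReach 5 x i j := by
  by_contra hij
  refine hc.not_forall_swapReach hι hx fun p q => ?_
  have hcase : ∀ p, H.SwapReach 5 x p i ∨ H.SwapReach 5 x p j := fun p => by
    rcases hH.swapReach_three hι hx p i j with h' | h' | h'
    · exact Or.inl h'
    · exact Or.inr h'
    · exact absurd h' hij
  rcases hcase p with hp | hp <;> rcases hcase q with hq | hq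
  · exact (hp.trans hx hq.comm).mono hx (by norm_num)
  · exact (hp.trans hx (hq.trans hx h.comm).comm).mono hx (by norm_num)
  · exact (hp.trans hx (hq.trans hx h).comm).mono hx (by norm_num)
  · exact (hp.trans hx hq.comm).mono hx (by norm_num)

theorem Avoids.swapReach_trans [Nonempty ι] (hc : H.Avoids c) (hH : H.LargeCodegree)
    (hι : Fintype.card ι = r) (hx : H.IsOrdering x) (h : H.SwapReach 5 x i j)
    (h' : H.SwapReach 5 x j k) : H.SwapReach 5 x i k :=
  hc.swapReach_five hH hι hx (h.trans hx h')

theorem Avoids.swapReach_step [Nonempty ι] (hc : H.Avoids c) (hH : H.LargeCodegree)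
    (hι : Fintype.card ι = r) (hxy : H.Step x y) (h : H.SwapReach 5 x i j) :
    H.SwapReach 5 y i j :=
  hc.swapReach_five hH hι hxy.2.1 ((h.of_reach hxy.reach).mono hxy.2.1 (by norm_num))

theorem exists_step_of_insert (hι : Fintype.card ι = r) {S : Finset V} {u v : V} (hu : u ∉ S)
    (hue : insert u S ∈ H.edges) (hve : insert v S ∈ H.edges) :
    ∃ (x y : ι → V) (i : ι), H.Step x y ∧ Finset.univ.image x = insert u S ∧
      Finset.univ.image y = insert v S ∧ x i = u ∧ y i = v ∧
      ∀ w ∈ S, ∃ j, x j = w ∧ y j = w := by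
  obtain ⟨x, hxe⟩ := exists_ordering hι hue
  have hx : H.IsOrdering x := by rw [IsOrdering, hxe]; exact hue
  have hinj := hx.injective hι
  obtain ⟨i, hi⟩ : ∃ i, x i = u := by
    have : u ∈ Finset.univ.image x := by rw [hxe]; simp
    simpa using this
  have hS : (Finset.univ.erase i).image x = S := by
    rw [Finset.image_erase hinj, hxe, hi, Finset.erase_insert hu]
  have hye : Finset.univ.image (Function.update x i v) = insert v S := by rw [image_update, hS]
  refine ⟨x, Function.update x i v, i, ⟨hx, by rw [IsOrdering, hye]; exact hve, i, v, rfl⟩, hxe,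
    hye, hi, by simp, ?_⟩
  intro w hw
  rw [← hS] at hw
  obtain ⟨j, hj, rfl⟩ := Finset.mem_image.1 hw
  exact ⟨j, rfl, by rw [Function.update_of_ne (Finset.ne_of_mem_erase hj)]⟩

theorem Avoids.isClassSystem [Nonempty ι] (hc : H.Avoids c) (hH : H.LargeCodegree)
    (hι : Fintype.card ι = r) : H.IsClassSystem (H.Exchangeable ι) := by
  have key : ∀ e ∈ H.edges, ∃ x : ι → V, H.IsOrdering x ∧ Finset.univ.image x = e ∧
      (∀ u ∈ e, ∃ i, x i = u) ∧
      ∀ i j, H.Exchangeable ι e (x i) (x j) ↔ H.SwapReach 5 x i j := by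
    intro e he
    obtain ⟨x, rfl⟩ := exists_ordering hι he
    exact ⟨x, he, rfl, fun u hu => by simpa using hu, fun i j => exchangeable_iff hι he⟩
  constructor
  · intro e he u hu
    obtain ⟨x, hx, rfl, hsurj, hiff⟩ := key e he
    obtain ⟨i, rfl⟩ := hsurj u hu
    exact (hiff i i).2 (.refl hx _ _)
  · intro e he u hu v hv h
    obtain ⟨x, hx, rfl, hsurj, hiff⟩ := key e he
    obtain ⟨i, rfl⟩ := hsurj u hu
    obtain ⟨j, rfl⟩ := hsurj v hv
    exact (hiff j i).2 ((hiff i j).1 h).comm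
  · intro e he u hu v hv w hw h h'
    obtain ⟨x, hx, rfl, hsurj, hiff⟩ := key e he
    obtain ⟨i, rfl⟩ := hsurj u hu
    obtain ⟨j, rfl⟩ := hsurj v hv
    obtain ⟨k, rfl⟩ := hsurj w hw
    exact (hiff i k).2 (hc.swapReach_trans hH hι hx ((hiff i j).1 h) ((hiff j k).1 h'))
  · intro e he u hu v hv w hw
    obtain ⟨x, hx, rfl, hsurj, hiff⟩ := key e he
    obtain ⟨i, rfl⟩ := hsurj u hu
    obtain ⟨j, rfl⟩ := hsurj v hv
    obtain ⟨k, rfl⟩ := hsurj w hw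
    rw [hiff, hiff, hiff]
    exact hH.swapReach_three hι hx i j k
  · intro e he
    obtain ⟨x, hx, rfl, hsurj, hiff⟩ := key e he
    by_contra! hcon
    refine hc.not_forall_swapReach hι hx fun i j => ?_
    exact ((hiff i j).1 (hcon (x i) (by simp) (x j) (by simp))).mono hx (by norm_num)
  · intro S a b ha _ hae hbe u hu v hv h
    obtain ⟨x, y, i, hxy, hxe, hye, -, -, hS⟩ := exists_step_of_insert (ι := ι) hι ha hae hbe
    obtain ⟨j, rfl, hj⟩ := hS u hu
    obtain ⟨k, rfl, hk⟩ := hS v hv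
    rw [← hxe, exchangeable_iff hι hxy.1] at h
    have := hc.swapReach_step hH hι hxy h
    rwa [← exchangeable_iff hι hxy.2.1, hye, hj, hk] at this
  · intro S a b ha _ hae hbe u hu h
    obtain ⟨x, y, i, hxy, hxe, hye, rfl, rfl, hS⟩ := exists_step_of_insert (ι := ι) hι ha hae hbe
    obtain ⟨j, rfl, hj⟩ := hS u hu
    rw [← hxe, exchangeable_iff hι hxy.1] at h
    have := hc.swapReach_step hH hι hxy h
    rwa [← exchangeable_iff hι hxy.2.1, hye, hj] at this
  · intro T hT u s w t v h0 h1 h2 h3 h4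
    obtain ⟨x, hx, hxe, hsurj, hiff⟩ := key _ h0
    obtain ⟨i, rfl⟩ := hsurj u (by simp)
    obtain ⟨j, rfl⟩ := hsurj v (by simp)
    have hd := Link.distinct hT h0
    have hij : i ≠ j := fun h => hd.1 (congrArg x h)
    have hTx : ((Finset.univ.erase i).erase j).image x = T := by
      rw [Finset.image_erase (hx.injective hι), Finset.image_erase (hx.injective hι), hxe,
        Finset.erase_insert (by simp [hd.1, hd.2.1]), Finset.erase_insert hd.2.2]
    rw [hiff]
    refine swapReach_of_walk (s := s) (w := w) (t := t) hij ?_ ?_ ?_ ?_ ?_ <;> rw [hTx] <;> assumption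

theorem LargeCodegree.exists_reach (hH : H.LargeCodegree) (hι : Fintype.card ι = r)
    (hr2 : 2 ≤ r) (hr : r ≤ Fintype.card V) (c : Equiv.Perm ι) (p : ι → Bool)
    (hp : ∀ i, p (c i) = p i) (hodd : Odd (Finset.univ.filter fun i => p i = true).card) :
    ∃ x : ι → V, H.IsOrdering x ∧ H.Reach (35 * r) x (x ∘ c) := by
  by_contra! hcon
  have hc : H.Avoids c := hcon
  have : Nonempty ι := Fintype.card_pos_iff.1 (by omega)
  have hE := hc.isClassSystem hH hι
  obtain ⟨χ, e, he, hcount, hχ⟩ := hE.exists_edge_colorCount_eq hH hr2 hr hodd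
    (by rw [← hι]; exact Finset.card_le_univ _)
  obtain ⟨y, rfl⟩ := exists_ordering hι he
  have hinj := IsOrdering.injective hι he
  have hcard : Fintype.card {i // p i = true} = Fintype.card {i // χ (y i) = true} := by
    rw [Fintype.card_subtype, Fintype.card_subtype, ← hcount, colorCount, Finset.filter_image,
      Finset.card_image_of_injective _ hinj]
  obtain ⟨f⟩ := Fintype.card_eq.1 hcard
  -- Reorder the edge so that its colour pattern is `p`. As `c` preserves `p`, it moves entries only
  -- within classes.
  set σ := f.extendSubtype with hσ
  have hx : H.IsOrdering (y ∘ σ) := IsOrdering.comp he σ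
  have hcol : ∀ i, χ (y (σ i)) = p i := fun i => by
    cases hpi : p i
    · have := f.extendSubtype_not_mem i (by simp [hpi])
      simpa using this
    · exact f.extendSubtype_mem i hpi
  refine hc (y ∘ σ) hx ?_
  have := reach_comp_perm (n := 5) hx (R := fun i j => p i = p j) (fun _ _ h => h.symm)
    (fun _ _ _ h h' => h.trans h') ?_ c (fun i => (hp i).symm)
  · exact this.mono hx (by rw [hι]; omega)
  · intro i j hij
    rw [← exchangeable_iff hι hx, image_comp_perm]
    refine (hχ _ (by simp) _ (by simp)).2 ?_
    simp only [Function.comp_apply]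
    rw [hcol, hcol]
    exact hij

end RGraph

/-! ### From ordered edges to homomorphic tight cycles. -/

namespace RGraph

variable {V : Type*} [Fintype V] [DecidableEq V] {r : ℕ} {H : RGraph V r}

theorem Reach.exists_sequence {ι : Type*} [Fintype ι] [DecidableEq ι] [Nonempty ι] {x y : ι → V}
    {n : ℕ} (hx : H.IsOrdering x) (h : H.Reach n x y) :
    ∃ s : ℕ → ι → V, s 0 = x ∧ (∀ q, n ≤ q → s q = y) ∧ ∀ q, H.Step (s q) (s (q + 1)) := by
  have hrefl : ∀ x : ι → V, H.IsOrdering x → H.Step x x := fun x hx => by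
    obtain ⟨i⟩ := ‹Nonempty ι›
    exact ⟨hx, hx, i, x i, by simp⟩
  induction n generalizing y with
  | zero =>
    cases h
    exact ⟨fun _ => x, rfl, fun _ _ => rfl, fun _ => hrefl x hx⟩
  | succ n ih =>
    obtain ⟨z, hz, hs⟩ := h
    obtain ⟨s, hs0, hsn, hstep⟩ := ih hz
    refine ⟨fun q => if q ≤ n then s q else y, by simp [hs0], fun q hq => if_neg (by omega), ?_⟩
    intro q
    rcases lt_trichotomy q n with hq | rfl | hq
    · simpa [hq.le, Nat.succ_le_of_lt hq] using hstep q
    · simpa [hsn q le_rfl] using hs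
    · simpa [not_le.2 hq, show ¬ q + 1 ≤ n by omega] using hrefl y hs.2.1

theorem image_window [NeZero r] {y : ZMod r → V} (t : ℕ) :
    (Finset.range r).image (fun j => y ((t + j : ℕ) : ZMod r)) = Finset.univ.image y := by
  ext v
  simp only [Finset.mem_image, Finset.mem_range, Finset.mem_univ, true_and]
  constructor
  · rintro ⟨j, -, rfl⟩; exact ⟨_, rfl⟩
  · rintro ⟨b, rfl⟩
    exact ⟨(b - t).val, ZMod.val_lt _, by simp⟩

/-- A window takes its positions from `t % r` on from one block and the earlier ones from the next
block. The two blocks differ in a single position `a`, so the window has the vertex set of the later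
block if `a` comes before `t % r`, and of the earlier block otherwise. -/
theorem window_mem_edges [NeZero r] {s : ℕ → ZMod r → V} (hs : ∀ q, H.Step (s q) (s (q + 1)))
    (t : ℕ) : (Finset.range r).image (fun j => s ((t + j) / r) ((t + j : ℕ) : ZMod r)) ∈ H.edges := by
  have hr : 0 < r := Nat.pos_of_ne_zero (NeZero.ne r)
  obtain ⟨h1, h2, a, v, hav⟩ := hs (t / r)
  have hdm := Nat.div_add_mod t r
  have hlt := Nat.mod_lt t hr
  have hagree : ∀ b : ZMod r, b ≠ a → s (t / r + 1) b = s (t / r) b := fun b hb => by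
    rw [hav, Function.update_of_ne hb]
  have hcase : ∀ j < r, ((t + j) / r = t / r ∧ (t + j) % r = t % r + j) ∨
      ((t + j) / r = t / r + 1 ∧ (t + j) % r + r = t % r + j) := by
    intro j hj
    by_cases h : t % r + j < r
    · left
      have : t + j = (t % r + j) + r * (t / r) := by omega
      rw [this, Nat.add_mul_div_left _ _ hr, Nat.add_mul_mod_self_left, Nat.div_eq_of_lt h,
        Nat.mod_eq_of_lt h]
      simp
    · right
      have h' : t % r + j - r < r := by omega
      have : t + j = (t % r + j - r) + r * (t / r + 1) := by rw [mul_add]; omega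
      rw [this, Nat.add_mul_div_left _ _ hr, Nat.add_mul_mod_self_left, Nat.div_eq_of_lt h',
        Nat.mod_eq_of_lt h']
      omega
  by_cases ha : a.val < t % r
  · have : (Finset.range r).image (fun j => s ((t + j) / r) ((t + j : ℕ) : ZMod r)) =
        (Finset.range r).image (fun j => s (t / r + 1) ((t + j : ℕ) : ZMod r)) := by
      refine Finset.image_congr fun j hj => ?_
      rcases hcase j (Finset.mem_range.1 hj) with ⟨e1, e2⟩ | ⟨e1, e2⟩
      · simp only [e1]
        refine (hagree _ ?_).symm
        rintro rfl
        rw [ZMod.val_natCast] at ha; omega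
      · simp only [e1]
    rw [this, image_window]; exact h2
  · have : (Finset.range r).image (fun j => s ((t + j) / r) ((t + j : ℕ) : ZMod r)) =
        (Finset.range r).image (fun j => s (t / r) ((t + j : ℕ) : ZMod r)) := by
      refine Finset.image_congr fun j hj => ?_
      rcases hcase j (Finset.mem_range.1 hj) with ⟨e1, e2⟩ | ⟨e1, e2⟩
      · simp only [e1]
      · simp only [e1]
        refine hagree _ ?_
        rintro rfl
        rw [ZMod.val_natCast] at ha
        have := Finset.mem_range.1 hj
        omega
    rw [this, image_window]; exact h1

theorem card_filter_dvd_val [NeZero r] {g : ℕ} (hg : g ∣ r) :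
    (Finset.univ.filter fun i : ZMod r => g ∣ i.val).card = r / g := by
  have hr : 0 < r := Nat.pos_of_ne_zero (NeZero.ne r)
  have hg0 : 0 < g := Nat.pos_of_dvd_of_pos hg hr
  have : (Finset.range (r / g)).card = (Finset.univ.filter fun i : ZMod r => g ∣ i.val).card := by
    have hlt : ∀ k < r / g, g * k < r := fun k hk => by
      calc g * k < g * (r / g) := Nat.mul_lt_mul_of_pos_left hk hg0
        _ = r := Nat.mul_div_cancel' hg
    refine Finset.card_bij (fun k _ => ((g * k : ℕ) : ZMod r)) ?_ ?_ ?_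
    · intro k hk
      simp only [Finset.mem_filter, Finset.mem_univ, true_and]
      rw [ZMod.val_natCast, Nat.mod_eq_of_lt (hlt k (Finset.mem_range.1 hk))]
      exact dvd_mul_right _ _
    · intro k hk k' hk' h
      have := congrArg ZMod.val h
      rw [ZMod.val_natCast, ZMod.val_natCast, Nat.mod_eq_of_lt (hlt k (Finset.mem_range.1 hk)),
        Nat.mod_eq_of_lt (hlt k' (Finset.mem_range.1 hk'))] at this
      exact Nat.eq_of_mul_eq_mul_left hg0 this
    · intro i hi
      obtain ⟨k, hk⟩ := (Finset.mem_filter.1 hi).2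
      refine ⟨k, ?_, by rw [← hk]; simp⟩
      rw [Finset.mem_range]
      have := ZMod.val_lt i
      rw [hk] at this
      exact (Nat.lt_div_iff_mul_lt' hg k).2 this
  rw [← this, Finset.card_range]

theorem dvd_val_add_iff [NeZero r] {g : ℕ} (hg : g ∣ r) {a : ZMod r} (ha : g ∣ a.val)
    (i : ZMod r) : g ∣ (i + a).val ↔ g ∣ i.val := by
  rw [ZMod.val_add, Nat.dvd_mod_iff hg, Nat.dvd_add_left ha]

theorem LargeCodegree.exists_hom_tightCycle (hH : H.LargeCodegree) (hr2 : 2 ≤ r)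
    (hr : r ≤ Fintype.card V) {ℓ : ℕ} (hℓ : r < ℓ) (hlarge : 35 * r * r ≤ ℓ)
    (hodd : Odd (r / Nat.gcd r ℓ)) :
    ∃ f : ZMod ℓ → V, ∀ e ∈ (tightCycle r ℓ hℓ).edges, e.image f ∈ H.edges := by
  have : NeZero r := ⟨by omega⟩
  have : NeZero ℓ := ⟨by omega⟩
  have hg := Nat.gcd_dvd_left r ℓ
  have hgv : Nat.gcd r ℓ ∣ ((ℓ : ℕ) : ZMod r).val := by
    rw [ZMod.val_natCast, Nat.dvd_mod_iff hg]; exact Nat.gcd_dvd_right r ℓ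
  -- The shift by `ℓ` preserves divisibility by `gcd(r, ℓ)`, and exactly `r / gcd(r, ℓ)` residues,
  -- an odd number, are divisible by it.
  obtain ⟨x, hx, hreach⟩ := hH.exists_reach (ι := ZMod r) (ZMod.card r) hr2 hr
    (Equiv.subRight ((ℓ : ℕ) : ZMod r)) (fun i => decide (Nat.gcd r ℓ ∣ i.val))
    (fun i => by
      simp only [Equiv.subRight_apply, decide_eq_decide]
      rw [← dvd_val_add_iff hg hgv, sub_add_cancel])
    (by simpa [card_filter_dvd_val hg] using hodd)
  obtain ⟨s, hs0, hsn, hs⟩ := hreach.exists_sequence hx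
  set w : ℕ → V := fun t => s (t / r) (t : ZMod r) with hw
  -- At least `35 * r` blocks lie before position `ℓ`, so the word has by then become constantly `x
  -- ∘ c`, whose entry at `ℓ + i` is `x i`.
  have hper : ∀ i < r, w (ℓ + i) = w i := by
    intro i hi
    have h1 : 35 * r ≤ (ℓ + i) / r := (Nat.le_div_iff_mul_le (by omega)).2 (by omega)
    simp only [hw]
    rw [hsn _ h1, Nat.div_eq_of_lt hi, hs0]
    simp
  refine ⟨fun t => w t.val, ?_⟩
  rintro e ⟨a, rfl⟩
  rw [Finset.image_image]
  have : (Finset.range r).image ((fun t : ZMod ℓ => w t.val) ∘ fun j : ℕ => a + (j : ZMod ℓ)) =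
      (Finset.range r).image (fun j => w (a.val + j)) := by
    refine Finset.image_congr fun j hj => ?_
    have hj := Finset.mem_range.1 hj
    have ha := ZMod.val_lt a
    simp only [Function.comp_apply]
    rw [ZMod.val_add, ZMod.val_natCast, Nat.mod_eq_of_lt (hj.trans hℓ)]
    by_cases h : a.val + j < ℓ
    · rw [Nat.mod_eq_of_lt h]
    · rw [Nat.mod_eq_sub_mod (by omega), Nat.mod_eq_of_lt (by omega), ← hper _ (by omega)]
      congr 1; omega
  rw [this]
  exact window_mem_edges hs a.val

end RGraph

namespace RGraph

/-! ### Random sampling of induced subhypergraphs. -/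

section Counting

variable {V U : Type*} [Fintype V] [DecidableEq V] [Fintype U] [DecidableEq U]

/-- Chernoff bound for the number of coordinates outside `S` at which a random function with
prescribed values on `S` lies in `D`. -/
theorem card_functions_few_hits_mul_exp_le (S : Finset V) (a : V → U) (D : Finset U) {c β : ℝ}
    (hc : 0 ≤ c) :
    ((Finset.univ.filter fun φ : V → U => (∀ v ∈ S, φ v = a v) ∧
      ((Finset.univ.filter fun v => v ∉ S ∧ φ v ∈ D).card : ℝ) < β).card : ℝ) *
        Real.exp (-(c * β)) ≤
      (Fintype.card U - D.card * (1 - Real.exp (-c))) ^ (Fintype.card V - S.card) := by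
  -- The product of these weights is the indicator of agreement with `a` on `S` times `exp (-c)` to
  -- the number of hits, and its sum over all `φ` factorises.
  set g : V → U → ℝ := fun v y =>
    if v ∈ S then (if y = a v then 1 else 0) else (if y ∈ D then Real.exp (-c) else 1) with hg
  have hg0 : ∀ v y, 0 ≤ g v y := fun v y => by
    simp only [hg]; split_ifs <;> positivity
  have hprod : ∑ φ : V → U, ∏ v, g v (φ v) =
      (Fintype.card U - D.card * (1 - Real.exp (-c))) ^ (Fintype.card V - S.card) := by
    rw [← Fintype.piFinset_univ, ← Finset.prod_univ_sum]
    have h1 : ∀ v, ∑ y, g v y =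
        if v ∈ S then 1 else (Fintype.card U - D.card * (1 - Real.exp (-c)) : ℝ) := by
      intro v
      simp only [hg]
      split_ifs with hv
      · simp
      · rw [Finset.sum_ite, Finset.sum_const, Finset.sum_const]
        have h2 := Finset.card_filter_add_card_filter_not (s := (Finset.univ : Finset U))
          (fun y => y ∈ D)
        have h3 : (Finset.univ.filter fun y => y ∈ D) = D := by ext; simp
        rw [Finset.card_univ] at h2
        rw [← h2, h3]
        push_cast
        simp only [nsmul_eq_mul]
        ring
    rw [Finset.prod_congr rfl fun v _ => h1 v, Finset.prod_ite, Finset.prod_const_one, one_mul,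
      Finset.prod_const]
    congr 1
    rw [Finset.filter_not, Finset.card_sdiff_of_subset (Finset.filter_subset _ _), Finset.card_univ]
    congr 2
    ext; simp
  rw [← hprod, ← nsmul_eq_mul, ← Finset.sum_const]
  refine (Finset.sum_le_sum fun φ hφ => ?_).trans
    (Finset.sum_le_sum_of_subset_of_nonneg (Finset.filter_subset _ _)
      fun φ _ _ => Finset.prod_nonneg fun v _ => hg0 v _)
  obtain ⟨hφa, hφ⟩ := (Finset.mem_filter.1 hφ).2
  have h1 : ∀ v, g v (φ v) = if v ∉ S ∧ φ v ∈ D then Real.exp (-c) else 1 := by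
    intro v
    simp only [hg]
    by_cases hv : v ∈ S
    · simp [hv, hφa v hv]
    · simp [hv]
  rw [Finset.prod_congr rfl fun v _ => h1 v, Finset.prod_ite, Finset.prod_const_one, mul_one,
    Finset.prod_const, ← Real.exp_nat_mul]
  refine Real.exp_le_exp.2 ?_
  nlinarith

theorem card_functions_few_hits_le (S : Finset V) (a : V → U) (D : Finset U) {α ε : ℝ}
    (hα0 : 0 ≤ α) (hα1 : α ≤ 1) (hε0 : 0 < ε) (hε1 : ε ≤ 1) (hD : α * Fintype.card U ≤ D.card) :
    ((Finset.univ.filter fun φ : V → U => (∀ v ∈ S, φ v = a v) ∧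
      ((Finset.univ.filter fun v => v ∉ S ∧ φ v ∈ D).card : ℝ) <
        (α - ε) * Fintype.card V).card : ℝ) ≤
      (Fintype.card U : ℝ) ^ (Fintype.card V - S.card) *
        Real.exp (S.card - ε ^ 2 / 4 * Fintype.card V) := by
  set m := Fintype.card V - S.card with hm
  set β := (α - ε) * Fintype.card V with hβ
  have h := card_functions_few_hits_mul_exp_le S a D (c := ε / 2) (β := β) (by positivity)
  -- This is `exp (-y) ≤ 1 - y + y ^ 2` at `y = ε / 2`.
  have hexp : ε / 2 - ε ^ 2 / 4 ≤ 1 - Real.exp (-(ε / 2)) := by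
    have := (abs_le.1 (Real.abs_exp_sub_one_sub_id_le (x := -(ε / 2))
      (by rw [abs_neg, abs_of_pos (by positivity)]; linarith))).2
    nlinarith
  have hU : (0 : ℝ) ≤ Fintype.card U := Nat.cast_nonneg _
  have hbase : (Fintype.card U - D.card * (1 - Real.exp (-(ε / 2))) : ℝ) ≤
      Fintype.card U * Real.exp (-(α * (ε / 2 - ε ^ 2 / 4))) := by
    have h1 : (Fintype.card U : ℝ) * (1 - α * (ε / 2 - ε ^ 2 / 4)) ≤
        Fintype.card U * Real.exp (-(α * (ε / 2 - ε ^ 2 / 4))) :=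
      mul_le_mul_of_nonneg_left (by linarith [Real.add_one_le_exp (-(α * (ε / 2 - ε ^ 2 / 4)))]) hU
    have h2 : 0 ≤ ε / 2 - ε ^ 2 / 4 := by nlinarith
    have h3 : α * Fintype.card U * (ε / 2 - ε ^ 2 / 4) ≤
        D.card * (1 - Real.exp (-(ε / 2))) :=
      mul_le_mul hD hexp h2 (Nat.cast_nonneg _)
    linarith
  have hbase0 : (0 : ℝ) ≤ Fintype.card U - D.card * (1 - Real.exp (-(ε / 2))) := by
    have h1 : (D.card : ℝ) ≤ Fintype.card U := by exact_mod_cast Finset.card_le_univ D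
    have h2 : 1 - Real.exp (-(ε / 2)) ≤ 1 := by linarith [Real.exp_pos (-(ε / 2))]
    have h3 : (D.card : ℝ) * (1 - Real.exp (-(ε / 2))) ≤ D.card * 1 :=
      mul_le_mul_of_nonneg_left h2 (Nat.cast_nonneg _)
    linarith
  have hpow := pow_le_pow_left₀ hbase0 hbase m
  rw [mul_pow, ← Real.exp_nat_mul] at hpow
  have hle := h.trans hpow
  rw [Real.exp_neg, ← div_eq_mul_inv, div_le_iff₀ (Real.exp_pos _), mul_assoc, ← Real.exp_add] at hle
  refine hle.trans (mul_le_mul_of_nonneg_left (Real.exp_le_exp.2 ?_) (by positivity))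
  have hmr : (Fintype.card V : ℝ) - S.card = m := by
    rw [hm, Nat.cast_sub (Finset.card_le_univ S)]
  rw [← hmr, hβ]
  have hV : (0 : ℝ) ≤ Fintype.card V := Nat.cast_nonneg _
  have hS : (0 : ℝ) ≤ S.card := Nat.cast_nonneg _
  have e1 : α * (ε / 2 - ε ^ 2 / 4) ≤ 1 := by
    have : ε / 2 - ε ^ 2 / 4 ≤ 1 := by nlinarith
    nlinarith
  have e2 : α * (ε ^ 2 / 4) ≤ ε ^ 2 / 4 := by nlinarith [sq_nonneg ε]
  have e3 := mul_le_mul_of_nonneg_right e1 hS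
  have e4 := mul_le_mul_of_nonneg_right e2 hV
  nlinarith

/-- Conditioning on the values on `S`: the set to be hit depends on `φ` only through these values.
-/
theorem card_functions_le_of_restrict (S : Finset V) (p : (V → U) → Prop) [DecidablePred p]
    {K : ℝ} (hK : ∀ a : V → U, p a →
      ((Finset.univ.filter fun φ : V → U => (∀ v ∈ S, φ v = a v) ∧ p φ).card : ℝ) ≤ K)
    (hK0 : 0 ≤ K) :
    ((Finset.univ.filter p).card : ℝ) ≤ (Fintype.card U : ℝ) ^ S.card * K := by
  have h1 := Finset.card_eq_sum_card_fiberwise (s := Finset.univ.filter p)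
    (t := (Finset.univ : Finset (S → U))) (f := fun (φ : V → U) (v : S) => φ v) (fun _ _ => by simp)
  rw [h1]
  push_cast
  have h2 : (Fintype.card U : ℝ) ^ S.card * K = ∑ _b : S → U, K := by
    rw [Finset.sum_const, Finset.card_univ, Fintype.card_fun, Fintype.card_coe, nsmul_eq_mul]
    push_cast; rfl
  rw [h2]
  refine Finset.sum_le_sum fun b _ => ?_
  rcases Finset.eq_empty_or_nonempty
    ((Finset.univ.filter p).filter fun φ : V → U => (fun v : S => φ v) = b) with he | ⟨a, ha⟩
  · rw [he]; simpa using hK0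
  · rw [Finset.mem_filter, Finset.mem_filter] at ha
    refine le_trans ?_ (hK a ha.1.2)
    norm_cast
    refine Finset.card_le_card fun φ hφ => ?_
    rw [Finset.mem_filter, Finset.mem_filter] at hφ
    rw [Finset.mem_filter]
    refine ⟨Finset.mem_univ _, fun v hv => ?_, hφ.1.2⟩
    exact congrFun (hφ.2.trans ha.2.symm) ⟨v, hv⟩

end Counting

/-- The hypergraph induced by `H` along `φ`. -/
def pullback {V U : Type*} [DecidableEq U] {r : ℕ} (H : RGraph U r) (φ : V → U) : RGraph V r where
  edges := {e | e.card = r ∧ e.image φ ∈ H.edges}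
  card_eq _ he := he.1

theorem filter_subset_neighbors_pullback {V U : Type*} [Fintype V] [DecidableEq V] [Fintype U]
    [DecidableEq U] {r : ℕ} (H : RGraph U r) (φ : V → U) {S : Finset V} (hS : S.card + 1 = r) :
    (Finset.univ.filter fun v => v ∉ S ∧ φ v ∈ H.neighbors (S.image φ)) ⊆
      (H.pullback φ).neighbors S := by
  intro v hv
  simp only [Finset.mem_filter, Finset.mem_univ, true_and, mem_neighbors] at hv
  rw [mem_neighbors]
  refine ⟨hv.1, ?_, ?_⟩
  · rw [Finset.card_insert_of_notMem hv.1, hS]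
  · rw [Finset.image_insert]; exact hv.2.2

open Classical in
/-- The injective maps along which `H` induces an `r`-graph with codegree at least `β`. -/
noncomputable def goodSamples {V U : Type*} [Fintype V] [DecidableEq V] [Fintype U] [DecidableEq U]
    {r : ℕ} (H : RGraph U r) (β : ℝ) : Finset (V → U) :=
  Finset.univ.filter fun φ => Function.Injective φ ∧
    ∀ S : Finset V, S.card + 1 = r → β ≤ ((H.pullback φ).neighbors S).card

/-- Union bound over the `(r - 1)`-sets `S`. Once `φ` is fixed on `S`, the neighbourhood of `S.image
φ` is fixed and the Chernoff bound applies to the remaining coordinates. -/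
theorem card_le_card_goodSamples {V U : Type*} [Fintype V] [DecidableEq V] [Fintype U]
    [DecidableEq U] {r : ℕ} (H : RGraph U r) {α ε : ℝ} (hα0 : 0 ≤ α) (hα1 : α ≤ 1) (hε0 : 0 < ε)
    (hε1 : ε ≤ 1) (hH : ∀ S : Finset U, S.card + 1 = r → α * Fintype.card U ≤ (H.neighbors S).card)
    (hr : 1 ≤ r) (hrV : r ≤ Fintype.card V) :
    ((Fintype.card U).descFactorial (Fintype.card V) : ℝ) ≤
      (goodSamples (V := V) H ((α - ε) * Fintype.card V)).card +
        (Fintype.card V : ℝ) ^ r * ((Fintype.card U : ℝ) ^ Fintype.card V *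
          Real.exp (r - ε ^ 2 / 4 * Fintype.card V)) := by
  classical
  set β := (α - ε) * Fintype.card V with hβ
  set 𝒮 := (Finset.univ : Finset V).powersetCard (r - 1) with h𝒮
  let bad : Finset V → (V → U) → Prop := fun S φ => Function.Injective φ ∧
    ((Finset.univ.filter fun v => v ∉ S ∧ φ v ∈ H.neighbors (S.image φ)).card : ℝ) < β
  have hcover : (Finset.univ.filter fun φ : V → U => Function.Injective φ) ⊆
      goodSamples H β ∪ 𝒮.biUnion fun S => Finset.univ.filter (bad S) := by
    intro φ hφ
    have hφ := (Finset.mem_filter.1 hφ).2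
    by_cases hgood : φ ∈ goodSamples (V := V) H β
    · exact Finset.mem_union_left _ hgood
    · refine Finset.mem_union_right _ ?_
      simp only [goodSamples, Finset.mem_filter, Finset.mem_univ, true_and, not_and, not_forall,
        not_le] at hgood
      obtain ⟨S, hS, hlt⟩ := hgood hφ
      rw [Finset.mem_biUnion]
      refine ⟨S, by rw [h𝒮, Finset.mem_powersetCard]; exact ⟨Finset.subset_univ _, by omega⟩, ?_⟩
      rw [Finset.mem_filter]
      refine ⟨Finset.mem_univ _, hφ, lt_of_le_of_lt ?_ hlt⟩
      exact_mod_cast Finset.card_le_card (filter_subset_neighbors_pullback H φ hS)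
  have hinj : (Finset.univ.filter fun φ : V → U => Function.Injective φ).card =
      (Fintype.card U).descFactorial (Fintype.card V) := by
    rw [← Fintype.card_subtype, ← Fintype.card_embedding_eq]
    exact Fintype.card_congr (Equiv.subtypeInjectiveEquivEmbedding V U)
  have hS : ∀ S ∈ 𝒮, ((Finset.univ.filter (bad S)).card : ℝ) ≤
      (Fintype.card U : ℝ) ^ Fintype.card V * Real.exp (r - ε ^ 2 / 4 * Fintype.card V) := by
    intro S hS
    have hSc : S.card + 1 = r := by
      have := (Finset.mem_powersetCard.1 hS).2; omega
    have hSV : S.card ≤ Fintype.card V := Finset.card_le_univ S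
    refine (card_functions_le_of_restrict S (bad S) (K := (Fintype.card U : ℝ) ^
      (Fintype.card V - S.card) * Real.exp (S.card - ε ^ 2 / 4 * Fintype.card V)) ?_
      (by positivity)).trans ?_
    · intro a ha
      have hD := hH (S.image a) (by rw [Finset.card_image_of_injective _ ha.1]; exact hSc)
      refine le_trans ?_ (card_functions_few_hits_le S a (H.neighbors (S.image a)) hα0 hα1 hε0 hε1 hD)
      norm_cast
      refine Finset.card_le_card fun φ hφ => ?_
      rw [Finset.mem_filter] at hφ ⊢
      obtain ⟨-, h1, -, h2⟩ := hφ
      refine ⟨Finset.mem_univ _, h1, ?_⟩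
      rwa [show S.image φ = S.image a from Finset.image_congr fun v hv => h1 v hv] at h2
    · rw [← mul_assoc, ← pow_add, Nat.add_sub_cancel' hSV]
      refine mul_le_mul_of_nonneg_left (Real.exp_le_exp.2 ?_) (by positivity)
      have : (S.card : ℝ) ≤ r := by exact_mod_cast (by omega : S.card ≤ r)
      linarith
  have h𝒮c : (𝒮.card : ℝ) ≤ (Fintype.card V : ℝ) ^ r := by
    rw [h𝒮, Finset.card_powersetCard, Finset.card_univ]
    have h1 : (Fintype.card V).choose (r - 1) ≤ Fintype.card V ^ (r - 1) := Nat.choose_le_pow _ _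
    have h2 : Fintype.card V ^ (r - 1) ≤ Fintype.card V ^ r :=
      Nat.pow_le_pow_right (by omega) (by omega)
    exact_mod_cast h1.trans h2
  rw [← hinj]
  have hc1 : ((Finset.univ.filter fun φ : V → U => Function.Injective φ).card : ℝ) ≤
      (goodSamples (V := V) H β).card + ∑ S ∈ 𝒮, ((Finset.univ.filter (bad S)).card : ℝ) := by
    exact_mod_cast (Finset.card_le_card hcover).trans ((Finset.card_union_le _ _).trans
      (Nat.add_le_add_left Finset.card_biUnion_le _))
  refine hc1.trans (add_le_add le_rfl ?_)
  refine (Finset.sum_le_sum hS).trans ?_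
  rw [Finset.sum_const, nsmul_eq_mul]
  exact mul_le_mul_of_nonneg_right h𝒮c (by positivity)

theorem exists_forall_pow_mul_exp_le (r : ℕ) {b : ℝ} (hb : 0 < b) :
    ∃ n₀ : ℕ, ∀ n : ℕ, n₀ ≤ n → (n : ℝ) ^ r * Real.exp (r - b * n) ≤ 1 / 4 := by
  have h := (isLittleO_pow_exp_pos_mul_atTop r hb).def
    (show (0 : ℝ) < 1 / 4 * Real.exp (-r) by positivity)
  have h' := tendsto_natCast_atTop_atTop.eventually h
  obtain ⟨n₀, hn₀⟩ := eventually_atTop.1 h'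
  refine ⟨n₀, fun n hn => ?_⟩
  have := hn₀ n hn
  rw [Real.norm_of_nonneg (by positivity), Real.norm_of_nonneg (by positivity)] at this
  calc (n : ℝ) ^ r * Real.exp (r - b * n)
      ≤ (1 / 4 * Real.exp (-r) * Real.exp (b * n)) * Real.exp (r - b * n) :=
        mul_le_mul_of_nonneg_right this (Real.exp_pos _).le
    _ = 1 / 4 * Real.exp (-r + b * n + (r - b * n)) := by rw [Real.exp_add, Real.exp_add]; ring
    _ = 1 / 4 := by
        rw [show -(r : ℝ) + b * n + (r - b * n) = 0 by ring, Real.exp_zero, mul_one]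

theorem pow_mul_one_sub_le_descFactorial {n N : ℕ} (hN : 0 < N) (hnN : n ≤ N) :
    (N : ℝ) ^ n * (1 - n ^ 2 / N) ≤ N.descFactorial n := by
  have hN0 : (0 : ℝ) < N := by exact_mod_cast hN
  have h1 : (((N + 1 - n) ^ n : ℕ) : ℝ) ≤ N.descFactorial n := by
    exact_mod_cast Nat.pow_sub_le_descFactorial N n
  refine le_trans ?_ h1
  rw [Nat.cast_pow, Nat.cast_sub (by omega)]
  push_cast
  have hq : (n : ℝ) / N ≤ 1 := by
    rw [div_le_one hN0]; exact_mod_cast hnN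
  have h2 := one_add_mul_le_pow (a := -((n : ℝ) / N)) (by linarith) n
  have h3 : (1 - n ^ 2 / N : ℝ) = 1 + n * -((n : ℝ) / N) := by ring
  have h5 : (N : ℝ) ^ n * (1 - n ^ 2 / N) ≤ (N * (1 + -((n : ℝ) / N))) ^ n := by
    rw [mul_pow, h3]
    exact mul_le_mul_of_nonneg_left h2 (by positivity)
  refine h5.trans (pow_le_pow_left₀ ?_ ?_ n)
  · exact mul_nonneg hN0.le (by linarith)
  · rw [mul_add, mul_one, mul_neg, mul_div_cancel₀ _ hN0.ne']; linarith

/-- At least half of all maps into a large `r`-graph of codegree density `α` are injective and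
induce an `r`-graph of codegree density at least `α - ε`. -/
theorem exists_forall_card_le_two_mul_card_goodSamples {r : ℕ} (hr : 1 ≤ r) {ε : ℝ} (hε0 : 0 < ε)
    (hε1 : ε ≤ 1) : ∃ n₀ : ℕ, ∀ n, n₀ ≤ n → ∀ N, 4 * n ^ 2 < N → ∀ H : RGraph (Fin N) r, ∀ α : ℝ,
      0 ≤ α → α ≤ 1 → (∀ S : Finset (Fin N), S.card + 1 = r → α * N ≤ (H.neighbors S).card) →
      (N : ℝ) ^ n ≤ 2 * (goodSamples (V := Fin n) H ((α - ε) * n)).card := by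
  obtain ⟨n₀, hn₀⟩ := exists_forall_pow_mul_exp_le r (b := ε ^ 2 / 4) (by positivity)
  refine ⟨max n₀ r, fun n hn N hN H α hα0 hα1 hH => ?_⟩
  have h1 := card_le_card_goodSamples (V := Fin n) H hα0 hα1 hε0 hε1
    (by simpa using hH) hr (by rw [Fintype.card_fin]; exact (le_max_right _ _).trans hn)
  have h2 := hn₀ n ((le_max_left _ _).trans hn)
  have hN0 : (0 : ℝ) < N := by exact_mod_cast (by omega : 0 < N)
  have h3 := pow_mul_one_sub_le_descFactorial (n := n) (N := N) (by omega) (by nlinarith)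
  -- Non-injective maps make up at most a quarter of all maps because `4 * n ^ 2 < N`; maps with a
  -- small codegree make up at most another quarter.
  have h5 : (N : ℝ) ^ n * (3 / 4) ≤ (N : ℝ) ^ n * (1 - n ^ 2 / N) := by
    refine mul_le_mul_of_nonneg_left ?_ (by positivity)
    have h6 : (4 : ℝ) * n ^ 2 < N := by exact_mod_cast hN
    have : (n : ℝ) ^ 2 / N ≤ 1 / 4 := by rw [div_le_iff₀ hN0]; linarith
    linarith
  simp only [Fintype.card_fin] at h1
  have h4 : (n : ℝ) ^ r * ((N : ℝ) ^ n * Real.exp (r - ε ^ 2 / 4 * n)) ≤ (N : ℝ) ^ n * (1 / 4) := by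
    calc _ = (N : ℝ) ^ n * ((n : ℝ) ^ r * Real.exp (r - ε ^ 2 / 4 * n)) := by ring
      _ ≤ _ := mul_le_mul_of_nonneg_left h2 (by positivity)
  linarith

end RGraph

namespace RGraph

/-! ### Boxes in dense sets of maps, and blow-ups. -/

section Box

/-- Double counting of tuples `s` of first coordinates against common tails `y`. By the power mean
inequality the average `s` has at least `c ^ (t + 1) * N ^ m` tails, and `hlarge` keeps the
contribution of the non-injective `s` below half of this. -/
theorem exists_injective_many_extensions {m t N : ℕ} {c : ℝ} (hc : 0 < c) (hN : 0 < N)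
    (htN : t + 1 ≤ N) (hlarge : 2 * (t + 1 : ℝ) ^ 2 < c ^ (t + 1) * N)
    (E : Finset (Fin (m + 1) → Fin N)) (hE : c * (N : ℝ) ^ (m + 1) ≤ E.card) :
    ∃ s : Fin (t + 1) → Fin N, Function.Injective s ∧ c ^ (t + 1) / 2 * (N : ℝ) ^ m ≤
      (Finset.univ.filter fun y : Fin m → Fin N => ∀ i, Fin.cons (s i) y ∈ E).card := by
  classical
  by_contra! hcon
  have hN0 : (0 : ℝ) < N := by exact_mod_cast hN
  set d : (Fin m → Fin N) → ℕ := fun y =>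
    (Finset.univ.filter fun a : Fin N => (Fin.cons a y : Fin (m + 1) → Fin N) ∈ E).card with hd
  have hsum : ∑ y, (d y : ℝ) = E.card := by
    have h1 : E.card = ∑ y, d y := by
      rw [Finset.card_eq_sum_card_fiberwise (s := E) (t := (Finset.univ : Finset (Fin m → Fin N)))
        (f := Fin.tail) (fun _ _ => by simp)]
      refine Finset.sum_congr rfl fun y _ => ?_
      refine Finset.card_bij' (fun φ _ => φ 0) (fun a _ => Fin.cons a y) ?_ ?_ ?_ ?_
      · intro φ hφ
        rw [Finset.mem_filter] at hφ
        rw [Finset.mem_filter]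
        refine ⟨Finset.mem_univ _, ?_⟩
        rw [← hφ.2, Fin.cons_self_tail]; exact hφ.1
      · intro a ha
        rw [Finset.mem_filter] at ha
        rw [Finset.mem_filter]
        exact ⟨ha.2, Fin.tail_cons _ _⟩
      · intro φ hφ
        rw [Finset.mem_filter] at hφ
        rw [← hφ.2, Fin.cons_self_tail]
      · intro a _; rfl
    rw [h1]; push_cast; rfl
  have hpow : ∀ y, ((d y : ℝ)) ^ (t + 1) =
      ((Finset.univ.filter fun s : Fin (t + 1) → Fin N =>
        ∀ i, (Fin.cons (s i) y : Fin (m + 1) → Fin N) ∈ E).card : ℝ) := by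
    intro y
    rw [← Nat.cast_pow]
    congr 1
    have : (Finset.univ.filter fun s : Fin (t + 1) → Fin N =>
        ∀ i, (Fin.cons (s i) y : Fin (m + 1) → Fin N) ∈ E) = Fintype.piFinset fun _ : Fin (t + 1) =>
          Finset.univ.filter fun a : Fin N => (Fin.cons a y : Fin (m + 1) → Fin N) ∈ E := by
      ext s; simp [Fintype.mem_piFinset]
    rw [this, Fintype.card_piFinset_const]
  have hswap : ∑ y, (d y : ℝ) ^ (t + 1) = ∑ s : Fin (t + 1) → Fin N,
      ((Finset.univ.filter fun y : Fin m → Fin N => ∀ i, Fin.cons (s i) y ∈ E).card : ℝ) := by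
    rw [Finset.sum_congr rfl fun y _ => hpow y]
    have := Finset.sum_card_bipartiteAbove_eq_sum_card_bipartiteBelow
      (s := (Finset.univ : Finset (Fin m → Fin N)))
      (t := (Finset.univ : Finset (Fin (t + 1) → Fin N)))
      (fun y s => ∀ i, (Fin.cons (s i) y : Fin (m + 1) → Fin N) ∈ E)
    unfold Finset.bipartiteAbove Finset.bipartiteBelow at this
    exact_mod_cast this
  have hlow : (c * N) ^ (t + 1) * (N : ℝ) ^ m ≤ ∑ y, (d y : ℝ) ^ (t + 1) := by
    have h1 := pow_sum_div_card_le_sum_pow (s := (Finset.univ : Finset (Fin m → Fin N)))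
      (f := fun y => (d y : ℝ)) (fun y _ => Nat.cast_nonneg _) t
    refine le_trans ?_ h1
    rw [hsum, Finset.card_univ, Fintype.card_fun, Fintype.card_fin, Fintype.card_fin, Nat.cast_pow,
      le_div_iff₀ (by positivity)]
    calc (c * N) ^ (t + 1) * (N : ℝ) ^ m * ((N : ℝ) ^ m) ^ t = (c * (N : ℝ) ^ (m + 1)) ^ (t + 1) := by
          ring
      _ ≤ _ := pow_le_pow_left₀ (by positivity) hE _
  have hup : ∑ s : Fin (t + 1) → Fin N,
      ((Finset.univ.filter fun y : Fin m → Fin N => ∀ i, Fin.cons (s i) y ∈ E).card : ℝ) ≤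
      (N : ℝ) ^ (t + 1) * ((t + 1 : ℝ) ^ 2 / N) * (N : ℝ) ^ m +
        (N : ℝ) ^ (t + 1) * (c ^ (t + 1) / 2 * (N : ℝ) ^ m) := by
    rw [← Finset.sum_filter_add_sum_filter_not Finset.univ
      (fun s : Fin (t + 1) → Fin N => ¬ Function.Injective s)]
    refine add_le_add ?_ ?_
    · refine (Finset.sum_le_card_nsmul _ _ ((N : ℝ) ^ m) fun s _ => ?_).trans ?_
      · refine (Nat.cast_le.2 (Finset.card_le_univ _)).trans ?_
        simp
      · rw [nsmul_eq_mul]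
        refine mul_le_mul_of_nonneg_right ?_ (by positivity)
        have h1 := Finset.card_filter_add_card_filter_not
          (s := (Finset.univ : Finset (Fin (t + 1) → Fin N))) (fun s => Function.Injective s)
        have h2 : (Finset.univ.filter fun s : Fin (t + 1) → Fin N => Function.Injective s).card =
            N.descFactorial (t + 1) := by
          rw [← Fintype.card_subtype,
            Fintype.card_congr (Equiv.subtypeInjectiveEquivEmbedding _ _)]
          simp
        have h3 := pow_mul_one_sub_le_descFactorial hN htN
        rw [h2, Finset.card_univ, Fintype.card_fun, Fintype.card_fin, Fintype.card_fin] at h1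
        have h4 : (N.descFactorial (t + 1) : ℝ) + ((Finset.univ.filter
            fun s : Fin (t + 1) → Fin N => ¬ Function.Injective s).card : ℝ) = (N : ℝ) ^ (t + 1) := by
          exact_mod_cast h1
        push_cast at h3
        linarith
    · refine (Finset.sum_le_card_nsmul _ _ (c ^ (t + 1) / 2 * (N : ℝ) ^ m) fun s hs => ?_).trans ?_
      · rw [Finset.mem_filter, not_not] at hs
        exact (hcon s hs.2).le
      · rw [nsmul_eq_mul]
        refine mul_le_mul_of_nonneg_right ?_ (by positivity)
        refine (Nat.cast_le.2 (Finset.card_le_univ _)).trans ?_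
        simp
  have h := hlow.trans (hswap.le.trans hup)
  have hpos : (0 : ℝ) < (N : ℝ) ^ (t + 1) * (N : ℝ) ^ m := by positivity
  have h' : (N : ℝ) ^ (t + 1) * (N : ℝ) ^ m * c ^ (t + 1) ≤
      (N : ℝ) ^ (t + 1) * (N : ℝ) ^ m * ((t + 1 : ℝ) ^ 2 / N + c ^ (t + 1) / 2) := by
    rw [mul_pow] at h; linarith
  have h2 := le_of_mul_le_mul_left h' hpos
  have h3 : c ^ (t + 1) / 2 ≤ (t + 1 : ℝ) ^ 2 / N := by linarith
  rw [le_div_iff₀ hN0] at h3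
  linarith

/-- A dense set of maps contains all maps from a large box. -/
theorem exists_box_subset (m t : ℕ) {c : ℝ} (hc : 0 < c) : ∃ N₀ : ℕ, ∀ N, N₀ ≤ N →
    ∀ E : Finset (Fin m → Fin N), c * (N : ℝ) ^ m ≤ E.card →
      ∃ A : Fin m → Finset (Fin N), (∀ i, (A i).card = t + 1) ∧
        ∀ φ : Fin m → Fin N, (∀ i, φ i ∈ A i) → φ ∈ E := by
  classical
  induction m generalizing c with
  | zero =>
    refine ⟨0, fun N _ E hE => ⟨fun _ => ∅, fun i => i.elim0, fun φ _ => ?_⟩⟩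
    rw [pow_zero, mul_one] at hE
    obtain ⟨ψ, hψ⟩ := Finset.card_pos.1 (show 0 < E.card by exact_mod_cast hc.trans_le hE)
    rwa [Subsingleton.elim φ ψ]
  | succ m ih =>
    obtain ⟨N₁, hN₁⟩ := ih (c := c ^ (t + 1) / 2) (by positivity)
    obtain ⟨N₂, hN₂⟩ := exists_nat_gt (2 * (t + 1 : ℝ) ^ 2 / c ^ (t + 1))
    refine ⟨max N₁ (max N₂ (t + 1)), fun N hN E hE => ?_⟩
    simp only [max_le_iff] at hN
    obtain ⟨s, hs, hcard⟩ := exists_injective_many_extensions (t := t) hc (by omega) hN.2.2 (by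
      rw [div_lt_iff₀ (by positivity), mul_comm (N₂ : ℝ)] at hN₂
      refine hN₂.trans_le (mul_le_mul_of_nonneg_left ?_ (by positivity))
      exact_mod_cast hN.2.1) E hE
    obtain ⟨A, hA, hAE⟩ := hN₁ N hN.1 _ hcard
    refine ⟨Fin.cons (Finset.univ.image s) A, ?_, ?_⟩
    · intro i
      refine Fin.cases ?_ (fun i => ?_) i
      · rw [Fin.cons_zero, Finset.card_image_of_injective _ hs]; simp
      · rw [Fin.cons_succ]; exact hA i
    · intro φ hφ
      have h0 := hφ 0
      rw [Fin.cons_zero, Finset.mem_image] at h0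
      obtain ⟨i, -, hi⟩ := h0
      have h1 := hAE (Fin.tail φ) fun j => by
        have := hφ j.succ
        rwa [Fin.cons_succ] at this
      have h2 := (Finset.mem_filter.1 h1).2 i
      rwa [hi, Fin.cons_self_tail] at h2

end Box

/-- The map `g` may identify vertices of `F`, but each `A i` has room to separate them. Since an
edge meets every fibre of `g` at most once, its image is also the image under a single map of the
box. -/
theorem isContained_of_box {W : Type*} [Fintype W] {n N r : ℕ} {F : RGraph W r}
    {H : RGraph (Fin N) r} (g : W → Fin n) (A : Fin n → Finset (Fin N))
    (hA : ∀ i, (A i).card = Fintype.card W + 1)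
    (hinj : ∀ φ : Fin n → Fin N, (∀ i, φ i ∈ A i) → Function.Injective φ)
    (hhom : ∀ φ : Fin n → Fin N, (∀ i, φ i ∈ A i) →
      ∀ e ∈ F.edges, e.image (fun w => φ (g w)) ∈ H.edges) : F.IsContained H := by
  classical
  have hemb : ∀ i, Nonempty (W ↪ A i) := fun i =>
    Function.Embedding.nonempty_of_card_le (by rw [Fintype.card_coe, hA]; omega)
  let emb : ∀ i, W ↪ A i := fun i => (hemb i).some
  have hne : ∀ i, ∃ a, a ∈ A i := fun i => Finset.card_pos.1 (by rw [hA]; omega)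
  choose a ha using hne
  have hf : Function.Injective fun w => (emb (g w) w : Fin N) := by
    intro w w' hww
    by_cases hg : g w = g w'
    · have : (emb (g w) w : Fin N) = emb (g w) w' := by
        rw [show (emb (g w) w' : Fin N) = emb (g w') w' by rw [hg]]; exact hww
      exact (emb (g w)).injective (Subtype.ext this)
    · exfalso
      -- One map of the box takes both values, so its injectivity separates them.
      set φ : Fin n → Fin N := Function.update (Function.update a (g w) (emb (g w) w)) (g w')
        (emb (g w') w') with hφ
      refine hg (hinj φ ?_ ?_)
      · intro i
        by_cases h1 : i = g w'
        · subst h1; simp [hφ]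
        · by_cases h2 : i = g w
          · subst h2; simp [hφ, h1]
          · simp [hφ, h1, h2, ha]
      · simp only [hφ, Function.update_self, Function.update_of_ne hg]
        exact hww
  refine ⟨⟨_, hf⟩, fun e he => ?_⟩
  have hge : Set.InjOn g e := by
    have h1 := H.card_eq _ (hhom a ha e he)
    rw [← F.card_eq e he, Finset.card_image_iff] at h1
    exact fun w hw w' hw' h => h1 hw hw' (congrArg a h)
  set φ : Fin n → Fin N := fun i =>
    if h : ∃ w ∈ e, g w = i then (emb i h.choose : Fin N) else a i with hφ
  have hφA : ∀ i, φ i ∈ A i := by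
    intro i
    simp only [hφ]
    split_ifs with h
    · exact (emb i _).2
    · exact ha i
  have hφg : ∀ w ∈ e, φ (g w) = emb (g w) w := by
    intro w hw
    have h : ∃ w' ∈ e, g w' = g w := ⟨w, hw, rfl⟩
    simp only [hφ, dif_pos h]
    rw [hge h.choose_spec.1 hw h.choose_spec.2]
  have := hhom φ hφA e he
  rw [Finset.map_eq_image]
  convert this using 1
  exact Finset.image_congr fun w hw => (hφg w hw).symm

/-! ### Existence of the density and supersaturation. -/

section TuranNumber

variable {V W : Type*} [Fintype V] [DecidableEq V] {r : ℕ}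

theorem minDegree_le_card_neighbors (H : RGraph V r) {S : Finset V} (hS : S.card + 1 = r) :
    H.minDegree (r - 1) ≤ (H.neighbors S).card :=
  Nat.sInf_le ⟨S, by omega, degree_eq_card_neighbors H hS⟩

theorem le_minDegree (H : RGraph V r) (hr : 1 ≤ r) (hrV : r ≤ Fintype.card V) {d : ℕ}
    (h : ∀ S : Finset V, S.card + 1 = r → d ≤ (H.neighbors S).card) :
    d ≤ H.minDegree (r - 1) := by
  obtain ⟨S, -, hS⟩ := Finset.exists_subset_card_eq
    (show r - 1 ≤ (Finset.univ : Finset V).card by rw [Finset.card_univ]; omega)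
  refine le_csInf ⟨_, S, hS, rfl⟩ ?_
  rintro _ ⟨S, hS, rfl⟩
  have hS' : S.card + 1 = r := by omega
  rw [degree_eq_card_neighbors H hS']
  exact h S hS'

theorem minDegree_le_card (H : RGraph V r) (hr : 1 ≤ r) :
    H.minDegree (r - 1) ≤ Fintype.card V := by
  by_cases h : ∃ S : Finset V, S.card + 1 = r
  · obtain ⟨S, hS⟩ := h
    exact (minDegree_le_card_neighbors H hS).trans (Finset.card_le_univ _)
  · have : {d | ∃ S : Finset V, S.card = r - 1 ∧ H.degree S = d} = ∅ := by
      ext d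
      simp only [Set.mem_ofPred_eq, Set.mem_empty_iff_false, iff_false]
      rintro ⟨S, hS, -⟩
      exact h ⟨S, by omega⟩
    rw [minDegree, this, Nat.sInf_empty]
    exact Nat.zero_le _

theorem bddAbove_minDegree (F : RGraph W r) (hr : 1 ≤ r) (n : ℕ) :
    BddAbove {d | ∃ H : RGraph (Fin n) r, F.Free H ∧ H.minDegree (r - 1) = d} := by
  refine ⟨n, ?_⟩
  rintro _ ⟨H, -, rfl⟩
  simpa using H.minDegree_le_card hr

theorem Free.minDegree_le {F : RGraph W r} {n : ℕ} {H : RGraph (Fin n) r} (h : F.Free H)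
    (hr : 1 ≤ r) : H.minDegree (r - 1) ≤ F.codegreeTuranNumber n :=
  le_csSup (bddAbove_minDegree F hr n) ⟨H, h, rfl⟩

/-- Positivity rules out the default value `0` of the supremum of the empty set. -/
theorem exists_free_of_pos {F : RGraph W r} (hr : 1 ≤ r) {n : ℕ}
    (h : 0 < F.codegreeTuranNumber n) :
    ∃ H : RGraph (Fin n) r, F.Free H ∧ H.minDegree (r - 1) = F.codegreeTuranNumber n := by
  refine Nat.sSup_mem ?_ (bddAbove_minDegree F hr n)
  by_contra hne
  rw [Set.not_nonempty_iff_eq_empty] at hne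
  rw [codegreeTuranNumber, hne] at h
  simp at h

theorem codegreeTuranNumber_le (F : RGraph W r) (hr : 1 ≤ r) (n : ℕ) :
    F.codegreeTuranNumber n ≤ n := by
  rcases Nat.eq_zero_or_pos (F.codegreeTuranNumber n) with h | h
  · omega
  · obtain ⟨H, -, hH⟩ := exists_free_of_pos hr h
    rw [← hH]; simpa using H.minDegree_le_card hr

theorem Free.pullback {U : Type*} [DecidableEq U] {F : RGraph W r} {H : RGraph U r}
    (h : F.Free H) {φ : V → U} (hφ : Function.Injective φ) : F.Free (H.pullback φ) := by
  classical
  rintro ⟨f, hf⟩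
  refine h ⟨f.trans ⟨φ, hφ⟩, fun e he => ?_⟩
  have := (hf e he).2
  rw [Finset.map_eq_image, Finset.image_image] at this
  rw [Finset.map_eq_image]
  exact this

theorem exists_forall_eventually_codegree_le (F : RGraph W r) (hr : 1 ≤ r) {ε : ℝ} (hε0 : 0 < ε)
    (hε1 : ε ≤ 1) : ∃ n₀ : ℕ, ∀ n, n₀ ≤ n → ∀ᶠ N : ℕ in atTop,
      (F.codegreeTuranNumber N : ℝ) / N ≤ (F.codegreeTuranNumber n : ℝ) / n + ε := by
  obtain ⟨n₀, hn₀⟩ := exists_forall_card_le_two_mul_card_goodSamples hr hε0 hε1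
  refine ⟨max n₀ r, fun n hn => ?_⟩
  rw [max_le_iff] at hn
  filter_upwards [eventually_gt_atTop (4 * n ^ 2)] with N hN
  have hn0 : (0 : ℝ) < n := by exact_mod_cast (by omega : 0 < n)
  have hN0 : (0 : ℝ) < N := by exact_mod_cast (by omega : 0 < N)
  rcases Nat.eq_zero_or_pos (F.codegreeTuranNumber N) with h | h
  · rw [h]; simp only [Nat.cast_zero, zero_div]; positivity
  obtain ⟨H, hF, hH⟩ := exists_free_of_pos hr h
  set α : ℝ := (F.codegreeTuranNumber N : ℝ) / N with hα
  have hαN : α * N = F.codegreeTuranNumber N := div_mul_cancel₀ _ hN0.ne'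
  have h1 := hn₀ n hn.1 N hN H α (by positivity)
    (by rw [hα, div_le_one hN0]; exact_mod_cast codegreeTuranNumber_le F hr N)
    (fun S hS => by
      rw [hαN, ← hH]; exact_mod_cast minDegree_le_card_neighbors H hS)
  have hpos : (0 : ℝ) < (goodSamples (V := Fin n) H ((α - ε) * n)).card := by
    have : (0 : ℝ) < (N : ℝ) ^ n := by positivity
    linarith
  obtain ⟨φ, hφ⟩ := Finset.card_pos.1 (by exact_mod_cast hpos)
  simp only [goodSamples, Finset.mem_filter, Finset.mem_univ, true_and] at hφ
  have h2 := (hF.pullback hφ.1).minDegree_le hr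
  have h3 : ⌈(α - ε) * n⌉₊ ≤ (H.pullback φ).minDegree (r - 1) :=
    le_minDegree _ hr (by simpa using hn.2) fun S hS => Nat.ceil_le.2 (hφ.2 S hS)
  have h4 : (α - ε) * n ≤ F.codegreeTuranNumber n :=
    Nat.ceil_le.1 (h3.trans h2)
  rw [← le_div_iff₀ hn0] at h4
  linarith

/-- The codegree Turán density of every `r`-graph exists. -/
theorem hasCodegreeTuranDensity (F : RGraph W r) (hr : 1 ≤ r) : F.HasCodegreeTuranDensity := by
  set f : ℕ → ℝ := fun n => (F.codegreeTuranNumber n : ℝ) / n with hf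
  have hf0 : ∀ n, 0 ≤ f n := fun n => by simp only [hf]; positivity
  have hf1 : ∀ n, f n ≤ 1 := fun n =>
    div_le_one_of_le₀ (by exact_mod_cast codegreeTuranNumber_le F hr n) (Nat.cast_nonneg _)
  have hbelow : IsBoundedUnder (· ≥ ·) atTop f := isBoundedUnder_of ⟨0, hf0⟩
  have habove : IsBoundedUnder (· ≤ ·) atTop f := isBoundedUnder_of ⟨1, hf1⟩
  -- Sampling gives `f N ≤ f n + ε` for all `N` large in terms of `n`: take the limsup in `N`, then
  -- the liminf in `n`.
  have hle : limsup f atTop ≤ liminf f atTop := by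
    refine le_of_forall_pos_le_add fun ε hε => ?_
    obtain ⟨n₀, hn₀⟩ := exists_forall_eventually_codegree_le F hr (ε := min ε 1)
      (by positivity) (min_le_right _ _)
    have h1 : ∀ n, n₀ ≤ n → limsup f atTop - ε ≤ f n := fun n hn => by
      have := limsup_le_of_le hbelow.isCoboundedUnder_le (hn₀ n hn)
      have h2 := min_le_left ε 1
      linarith
    have h2 : limsup f atTop - ε ≤ liminf f atTop :=
      le_liminf_of_le habove.isCoboundedUnder_ge
        (eventually_atTop.2 ⟨n₀, h1⟩)
    linarith
  have h := tendsto_of_le_liminf_of_limsup_le le_rfl hle habove hbelow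
  rw [HasCodegreeTuranDensity, codegreeTuranDensity, h.limUnder_eq]
  exact h

/-- At least half of all samples are good and contain a homomorphic image. Pigeonhole over the
finitely many `g` leaves a proportion `c` of all maps sharing the same `g`, and a box among these
gives a copy of `F`. -/
theorem isContained_of_eventually_hom [Fintype W] (F : RGraph W r) (hr : 1 ≤ r) {α ε : ℝ}
    (hα : 0 ≤ α) (hε : 0 < ε) (hαε : α + ε ≤ 1)
    (h : ∃ n₁ : ℕ, ∀ n, n₁ ≤ n → ∀ H : RGraph (Fin n) r,
      (∀ S : Finset (Fin n), S.card + 1 = r → (α + ε / 2) * n ≤ (H.neighbors S).card) →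
        ∃ g : W → Fin n, ∀ e ∈ F.edges, e.image g ∈ H.edges) :
    ∃ N₀ : ℕ, ∀ N, N₀ ≤ N → ∀ H : RGraph (Fin N) r,
      (∀ S : Finset (Fin N), S.card + 1 = r → (α + ε) * N ≤ (H.neighbors S).card) →
        F.IsContained H := by
  classical
  obtain ⟨n₁, hn₁⟩ := h
  obtain ⟨n₀, hn₀⟩ := exists_forall_card_le_two_mul_card_goodSamples hr (ε := ε / 2)
    (by positivity) (by linarith)
  set n := max (max n₀ n₁) 1 with hn
  have hcpos : (0 : ℝ) < Fintype.card (W → Fin n) := by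
    have : Nonempty (Fin n) := ⟨⟨0, by omega⟩⟩
    exact_mod_cast Fintype.card_pos
  set c : ℝ := 1 / (2 * Fintype.card (W → Fin n)) with hc
  obtain ⟨N₁, hN₁⟩ := exists_box_subset n (Fintype.card W) (c := c) (by positivity)
  refine ⟨max N₁ (4 * n ^ 2 + 1), fun N hN H hH => ?_⟩
  rw [max_le_iff] at hN
  have h1 := hn₀ n (by omega) N (by omega) H (α + ε) (by linarith) hαε hH
  rw [show α + ε - ε / 2 = α + ε / 2 by ring] at h1
  set G := goodSamples (V := Fin n) H ((α + ε / 2) * n) with hG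
  have hmemG : ∀ φ ∈ G, Function.Injective φ ∧ ∃ g : W → Fin n, ∀ e ∈ F.edges,
      e.image g ∈ (H.pullback φ).edges := by
    intro φ hφ
    simp only [hG, goodSamples, Finset.mem_filter, Finset.mem_univ, true_and] at hφ
    exact ⟨hφ.1, hn₁ n (by omega) _ hφ.2⟩
  let E : (W → Fin n) → Finset (Fin n → Fin N) := fun g =>
    G.filter fun φ => ∀ e ∈ F.edges, e.image g ∈ (H.pullback φ).edges
  obtain ⟨g, hg⟩ : ∃ g, c * (N : ℝ) ^ n ≤ (E g).card := by
    by_contra! hcon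
    have hsub : G ⊆ Finset.univ.biUnion E := by
      intro φ hφ
      obtain ⟨g, hg⟩ := (hmemG φ hφ).2
      exact Finset.mem_biUnion.2 ⟨g, Finset.mem_univ _, Finset.mem_filter.2 ⟨hφ, hg⟩⟩
    have h2 : (G.card : ℝ) ≤ ∑ g, ((E g).card : ℝ) := by
      exact_mod_cast (Finset.card_le_card hsub).trans Finset.card_biUnion_le
    have h3 : ∑ g, ((E g).card : ℝ) < ∑ _g : W → Fin n, c * (N : ℝ) ^ n := by
      refine Finset.sum_lt_sum_of_nonempty ?_ fun g _ => hcon g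
      exact Finset.card_pos.1 (by rw [Finset.card_univ]; exact_mod_cast hcpos)
    rw [Finset.sum_const, Finset.card_univ, nsmul_eq_mul, ← mul_assoc] at h3
    have h4 : (Fintype.card (W → Fin n) : ℝ) * c = 1 / 2 := by
      rw [hc]; field_simp
    rw [h4] at h3
    linarith
  obtain ⟨A, hA, hAE⟩ := hN₁ N hN.1 _ hg
  refine isContained_of_box g A hA (fun φ hφ => ?_) (fun φ hφ e he => ?_)
  · exact (hmemG φ (Finset.mem_filter.1 (hAE φ hφ)).1).1
  · have := ((Finset.mem_filter.1 (hAE φ hφ)).2 e he).2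
    rwa [Finset.image_image] at this

end TuranNumber

end RGraph

/-! ### The two bounds for tight cycles. -/

namespace RGraph

variable {r : ℕ}

theorem isContained_tightCycle (hr : 2 ≤ r) {ℓ : ℕ} (hℓ : r < ℓ) (hlarge : 35 * r * r ≤ ℓ)
    (hodd : Odd (r / Nat.gcd r ℓ)) {ε : ℝ} (hε : 0 < ε) (hε1 : ε ≤ 1 / 2) :
    ∃ N₀ : ℕ, ∀ N, N₀ ≤ N → ∀ H : RGraph (Fin N) r,
      (∀ S : Finset (Fin N), S.card + 1 = r → (1 / 3 + ε) * N ≤ (H.neighbors S).card) →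
        (tightCycle r ℓ hℓ).IsContained H := by
  have : NeZero ℓ := ⟨by omega⟩
  -- Beyond this size the surplus `3 * (ε / 2) * n` exceeds the `3 * r` required by `LargeCodegree`.
  obtain ⟨n₁, hn₁⟩ := exists_nat_gt (2 * r / ε)
  refine isContained_of_eventually_hom _ (by omega) (by norm_num) hε (by linarith)
    ⟨max n₁ r, fun n hn H hH => ?_⟩
  rw [max_le_iff] at hn
  have hlargeH : H.LargeCodegree := by
    intro S hS
    have h1 := hH S hS
    have h2 : (n₁ : ℝ) ≤ n := by exact_mod_cast hn.1
    rw [div_lt_iff₀ hε] at hn₁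
    have h3 : (n₁ : ℝ) * ε ≤ n * ε := mul_le_mul_of_nonneg_right h2 hε.le
    have hr0 : (0 : ℝ) < r := by exact_mod_cast (by omega : 0 < r)
    rw [Fintype.card_fin]
    have : ((n + 3 * r : ℕ) : ℝ) < ((3 * (H.neighbors S).card : ℕ) : ℝ) := by
      push_cast; linarith
    exact_mod_cast this
  exact hlargeH.exists_hom_tightCycle hr (by simpa using hn.2) hℓ hlarge hodd

theorem codegreeTuranDensity_tightCycle_le (hr : 2 ≤ r) {ℓ : ℕ} (hℓ : r < ℓ)
    (hlarge : 35 * r * r ≤ ℓ) (hodd : Odd (r / Nat.gcd r ℓ)) :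
    (tightCycle r ℓ hℓ).codegreeTuranDensity ≤ 1 / 3 := by
  refine le_of_forall_pos_le_add fun ε hε => ?_
  set δ := min ε (1 / 2) with hδ
  have hδ0 : 0 < δ := by positivity
  obtain ⟨N₀, hN₀⟩ := isContained_tightCycle hr hℓ hlarge hodd hδ0 (min_le_right _ _)
  refine le_of_tendsto (hasCodegreeTuranDensity (tightCycle r ℓ hℓ) (by omega)) ?_
  filter_upwards [eventually_ge_atTop N₀, eventually_gt_atTop 0] with N hN hNpos
  have hN0 : (0 : ℝ) < N := by exact_mod_cast hNpos
  rw [div_le_iff₀ hN0]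
  refine le_trans ?_ (mul_le_mul_of_nonneg_right
    (add_le_add_right (min_le_left ε (1 / 2)) (1 / 3 : ℝ)) hN0.le)
  by_contra! hcon
  have hpos : 0 < (tightCycle r ℓ hℓ).codegreeTuranNumber N := by
    have : (0 : ℝ) < (tightCycle r ℓ hℓ).codegreeTuranNumber N :=
      lt_of_le_of_lt (by positivity) hcon
    exact_mod_cast this
  obtain ⟨H, hfree, hH⟩ := exists_free_of_pos (by omega) hpos
  refine hfree (hN₀ N hN H fun S hS => hcon.le.trans ?_)
  rw [← hH]
  exact_mod_cast minDegree_le_card_neighbors H hS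

/-- The `r`-graph on `Fin N` whose edges are the `r`-sets of sum `1` modulo `p`. -/
def sumOne (N r p : ℕ) : RGraph (Fin N) r where
  edges := {e | e.card = r ∧ ∑ v ∈ e, ((v : ℕ) : ZMod p) = 1}
  card_eq _ he := he.1

theorem sum_range_mul_of_periodic {M : Type*} [AddCommMonoid M] {h : ℕ → M} {g : ℕ}
    (hper : ∀ j, h (j + g) = h j) (d : ℕ) :
    ∑ j ∈ Finset.range (g * d), h j = d • ∑ j ∈ Finset.range g, h j := by
  have hper' : ∀ d j, h (g * d + j) = h j := by
    intro d j
    induction d with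
    | zero => simp
    | succ d ih => rw [mul_add, mul_one, add_right_comm, hper, ih]
  induction d with
  | zero => simp
  | succ d ih =>
    rw [mul_add, mul_one, Finset.sum_range_add, ih, succ_nsmul]
    simp only [hper']

/-- Consecutive edges have equal sums, so the residues have period `r` along the cycle, and by
Bézout period `gcd(r, ℓ)`. An edge then sums to `r / gcd(r, ℓ)` times the sum over a period, which
is `0` and not `1`. -/
theorem free_tightCycle_sumOne (N : ℕ) {p ℓ : ℕ} (hp : 1 < p) (hℓ : r < ℓ)
    (hdvd : p ∣ r / Nat.gcd r ℓ) : (tightCycle r ℓ hℓ).Free (sumOne N r p) := by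
  rintro ⟨f, hf⟩
  have : Fact (1 < p) := ⟨hp⟩
  set χ : ZMod ℓ → ZMod p := fun i => ((f i : ℕ) : ZMod p) with hχ
  have hsum : ∀ i, ∑ j ∈ Finset.range r, χ (i + (j : ZMod ℓ)) = 1 := by
    intro i
    have he : (Finset.range r).image (fun j : ℕ => i + (j : ZMod ℓ)) ∈ (tightCycle r ℓ hℓ).edges :=
      ⟨i, rfl⟩
    have h1 := (hf _ he).2
    have hc := (tightCycle r ℓ hℓ).card_eq _ he
    conv_rhs at hc => rw [← Finset.card_range r]
    rw [Finset.card_image_iff] at hc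
    rwa [Finset.sum_map, Finset.sum_image hc] at h1
  have hper : Function.Periodic χ (r : ZMod ℓ) := by
    intro i
    have h1 := hsum i
    have h2 := hsum (i + 1)
    have h3 := Finset.sum_range_succ (fun j : ℕ => χ (i + (j : ZMod ℓ))) r
    have h4 := Finset.sum_range_succ' (fun j : ℕ => χ (i + (j : ZMod ℓ))) r
    have h5 : ∀ j : ℕ, i + ((j + 1 : ℕ) : ZMod ℓ) = i + 1 + (j : ZMod ℓ) := fun j => by
      push_cast; ring
    simp only [h5, h2] at h4
    rw [h1, h4] at h3
    simpa using (add_left_cancel h3).symm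
  have hperg : Function.Periodic χ ((Nat.gcd r ℓ : ℕ) : ZMod ℓ) := by
    have h1 : ((Nat.gcd r ℓ : ℕ) : ZMod ℓ) = (Nat.gcdA r ℓ) • (r : ZMod ℓ) := by
      have := congrArg (Int.cast : ℤ → ZMod ℓ) (Nat.gcd_eq_gcd_ab r ℓ)
      push_cast at this
      rw [this]
      simp [mul_comm]
    rw [h1]
    exact hper.zsmul _
  have h0 := hsum 0
  have h1 := sum_range_mul_of_periodic (h := fun j : ℕ => χ (0 + (j : ZMod ℓ)))
    (g := Nat.gcd r ℓ) (fun j => by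
      have := hperg (0 + (j : ZMod ℓ))
      rwa [add_assoc, ← Nat.cast_add] at this) (r / Nat.gcd r ℓ)
  rw [Nat.mul_div_cancel' (Nat.gcd_dvd_left r ℓ), h0, nsmul_eq_mul,
    (ZMod.natCast_eq_zero_iff _ _).2 hdvd, zero_mul] at h1
  exact one_ne_zero h1

/-- The neighbours of `S` are the vertices outside `S` in one residue class modulo `p`, and each
class has at least `N / p` elements. -/
theorem le_card_neighbors_sumOne (N : ℕ) {p : ℕ} (hp : 0 < p) {S : Finset (Fin N)}
    (hS : S.card + 1 = r) : N / p - r ≤ ((sumOne N r p).neighbors S).card := by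
  have : NeZero p := ⟨hp.ne'⟩
  set c : ZMod p := 1 - ∑ v ∈ S, ((v : ℕ) : ZMod p) with hc
  have hsub : (Finset.univ.filter fun v : Fin N => ((v : ℕ) : ZMod p) = c) \ S ⊆
      (sumOne N r p).neighbors S := by
    intro v hv
    simp only [Finset.mem_sdiff, Finset.mem_filter, Finset.mem_univ, true_and] at hv
    rw [mem_neighbors]
    refine ⟨hv.2, ?_, ?_⟩
    · rw [Finset.card_insert_of_notMem hv.2, hS]
    · rw [Finset.sum_insert hv.2, hv.1, hc, sub_add_cancel]
  have hlt : ∀ k < N / p, p * k + c.val < N := fun k hk => by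
    have h1 := ZMod.val_lt c
    have h2 : p * (k + 1) ≤ p * (N / p) := Nat.mul_le_mul_left p hk
    have h3 := Nat.mul_div_le N p
    rw [mul_add, mul_one] at h2
    omega
  have hcard : N / p ≤ (Finset.univ.filter fun v : Fin N => ((v : ℕ) : ZMod p) = c).card := by
    conv_lhs => rw [← Fintype.card_fin (N / p), ← Finset.card_univ]
    refine Finset.card_le_card_of_injOn (fun k => ⟨p * k + c.val, hlt k k.2⟩) ?_ ?_
    · intro k _
      simp
    · intro k _ k' _ h
      have := congrArg Fin.val h
      simp only [Nat.add_right_cancel_iff] at this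
      exact Fin.ext (Nat.eq_of_mul_eq_mul_left hp this)
  have h1 := Finset.card_le_card hsub
  have h2 := Finset.le_card_sdiff S (Finset.univ.filter fun v : Fin N => ((v : ℕ) : ZMod p) = c)
  omega

theorem le_codegreeTuranDensity_tightCycle (hr : 1 ≤ r) {p ℓ : ℕ} (hp : 1 < p) (hℓ : r < ℓ)
    (hdvd : p ∣ r / Nat.gcd r ℓ) : (1 : ℝ) / p ≤ (tightCycle r ℓ hℓ).codegreeTuranDensity := by
  have hp0 : (0 : ℝ) < p := by exact_mod_cast (by omega : 0 < p)
  have hlim : Tendsto (fun N : ℕ => (1 : ℝ) / p - (r + 1) / N) atTop (𝓝 (1 / p)) := by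
    simpa using (tendsto_const_nhds (x := (1 : ℝ) / p)).sub
      (tendsto_const_div_atTop_nhds_zero_nat ((r : ℝ) + 1))
  refine le_of_tendsto_of_tendsto hlim
    (hasCodegreeTuranDensity (tightCycle r ℓ hℓ) hr) ?_
  filter_upwards [eventually_ge_atTop r] with N hN
  have hN0 : (0 : ℝ) < N := by exact_mod_cast (by omega : 0 < N)
  have h1 : N / p - r ≤ (tightCycle r ℓ hℓ).codegreeTuranNumber N :=
    (le_minDegree (sumOne N r p) hr (by simpa using hN) fun S hS =>
      le_card_neighbors_sumOne N (by omega) hS).trans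
        ((free_tightCycle_sumOne N hp hℓ hdvd).minDegree_le hr)
  have h2 : (N : ℝ) / p - 1 ≤ (N / p : ℕ) := by
    have : (N : ℝ) < p * ((N / p : ℕ) + 1) := by
      exact_mod_cast Nat.lt_mul_div_succ N (by omega : 0 < p)
    rw [sub_le_iff_le_add, div_le_iff₀ hp0]
    linarith
  have h3 : ((N / p : ℕ) : ℝ) ≤ (tightCycle r ℓ hℓ).codegreeTuranNumber N + r := by
    exact_mod_cast (by omega : N / p ≤ (tightCycle r ℓ hℓ).codegreeTuranNumber N + r)
  rw [le_div_iff₀ hN0, sub_mul, div_mul_cancel₀ _ hN0.ne', one_div, inv_mul_eq_div]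
  linarith

end RGraph

theorem theorem1p1 (r : ℕ) (hr : 2 ≤ r) :
    (∀ k : ℕ, ¬ k ≡ 0 [MOD r] → Odd (r / Nat.gcd r k) →
      ∃ L : ℕ, ∀ (ℓ : ℕ) (hℓ : r < ℓ), L < ℓ → ℓ ≡ k [MOD r] →
        (tightCycle r ℓ hℓ).HasCodegreeTuranDensity ∧
          (tightCycle r ℓ hℓ).codegreeTuranDensity ≤ 1 / 3) ∧
    (∃ L : ℕ, ∀ (ℓ : ℕ) (hℓ : r < ℓ), L < ℓ → (r / Nat.gcd r ℓ).minFac = 3 →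
      (tightCycle r ℓ hℓ).HasCodegreeTuranDensity ∧
        (tightCycle r ℓ hℓ).codegreeTuranDensity = 1 / 3) := by
  -- Room for `35 * r` steps, each taking one block of length `r`.
  refine ⟨fun k _ hodd => ⟨35 * r * r, fun ℓ hℓ hL hk => ?_⟩,
    ⟨35 * r * r, fun ℓ hℓ hL h3 => ?_⟩⟩
  · have hgcd : Nat.gcd r ℓ = Nat.gcd r k := by
      rw [Nat.gcd_comm r ℓ, Nat.gcd_comm r k]; exact hk.gcd_eq
    exact ⟨RGraph.hasCodegreeTuranDensity _ (by omega),
      RGraph.codegreeTuranDensity_tightCycle_le hr hℓ hL.le (by rwa [hgcd])⟩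
  · have hodd : Odd (r / Nat.gcd r ℓ) := by
      by_contra h
      rw [Nat.not_odd_iff_even] at h
      have := Nat.minFac_le_of_dvd le_rfl h.two_dvd
      omega
    have hdvd : 3 ∣ r / Nat.gcd r ℓ := h3 ▸ Nat.minFac_dvd _
    refine ⟨RGraph.hasCodegreeTuranDensity _ (by omega), le_antisymm
      (RGraph.codegreeTuranDensity_tightCycle_le hr hℓ hL.le hodd) ?_⟩
    simpa using RGraph.le_codegreeTuranDensity_tightCycle (by omega) (by norm_num : 1 < 3) hℓ hdvd
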